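/- **Setting.** Let $N$ be a finite set of configurations, $\Gamma$ a probability distribution over instances, $R(i,j)$ the execution time of configuration $i$ on instance $j$ (measurable in $j$), and $\kappa_0>0$ a constant with $R(i,j)\ge\kappa_0$ for all $i,j$. For $\theta>0$ let $R_\theta(i)=\mathrm E_{j\sim\Gamma}[\min\{R(i,j),\theta\}]$ and let $R(i)=\mathrm E_{j\sim\Gamma}[R(i,j)]\in(0,\infty]$, $OPT=\min_i R(i)$; a configuration $i^*$ is optimal if $R(i^*)=OPT$. Configuration $i$ is $(\varepsilon,\delta)$-optimal if there is a threshold $\theta>0$ with $R_\theta(i)\le(1+\varepsilon)OPT$ and $\Pr_{j\sim\Gamma}(R(i,j)>\theta)\le\delta$, and $(\varepsilon,\delta)$-suboptimal otherwise. We write $\log$ for the base-2 and $\ln$ for the natural logarithm. **Algorithm (Structured Procrastination with Confidence).** Each configuration $i$ has a tester with an infinite stream of i.i.d. instances from $\Gamma$ (streams of different testers may be equal or dependent in any way). Its state consists of the number $r_i$ of active instances (the first $r_i$ of the stream), a timeout threshold $\theta_i$, a FIFO queue $Q_i$ of pending instances, each with the timeout of its next run, and, for each active instance, the outcome of its most recent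 run (the running time if that run terminated, otherwise its timeout). Initially $r_i=0$, $\theta_i=\kappa_0$ and $Q_i$ is empty. In iteration $t=1,2,\dots$ the scheduler selects a configuration $i$ with the least lower confidence bound (ties are broken arbitrarily, by a measurable choice), and its tester makes one step: * if $|Q_i|<q(r_i,t)$, then $r_i$ is increased by 1 and the newly active instance is run with timeout $\theta=\theta_i$; * otherwise the head $(\ell,\theta')$ is removed from $Q_i$, $\theta_i$ is set to $\theta'$, and instance $\ell$ is run (from the start) with timeout $\theta=\theta'$. A run of instance $j$ with timeout $\theta$ takes time $\min\{R(i,j),\theta\}$; if $R(i,j)>\theta$, the instance is inserted at the tail of $Q_i$ with timeout $2\theta$. Here $q(r,t)=\max\{1,\lceil 50\log(t\cdot\max\{1,\log r\})\rceil\}$ (with $\max\{1,\log r\}=1$ for $r=0$). The lower confidence bound of tester $i$ in iteration $t$ is $0$ if $r_i=0$, and otherwise $$L(G_i,r_i,t)=\int_0^\infty\beta(1-G_i(x),r_i,t)\,dx,$$ where $G_i$ is the empirical CDF of the recorded outcomes of the $r_i$ active instances, $\beta(0,r,t)=0$ and, for $0<p\le1$, $$\beta(p,r,t)=\begin{cases}\dfrac{p}{1+\epsilon(k,r,t)}&\text{if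 }\epsilon(k,r,t)\le\frac12,\\[1ex]0&\text{otherwise,}\end{cases}\qquad \epsilon(k,r,t)=\sqrt{\frac{9\cdot2^k\ln(kt)}{r}},$$ with $k=\lfloor\log(1/p)\rfloor+1$, that is, $2^{-k}<p\le2^{1-k}$. **Statement.** There is an absolute constant $C>0$ such that the following holds for every such problem and every such run of the algorithm. Let $i^*$ be an optimal configuration and let $i$ be $(\varepsilon_i,\delta_i)$-suboptimal, where $0<\varepsilon_i\le1$ and $0<\delta_i<1$. Then for every integer $t\ge\max\{2,\log(1/\delta_i)^{-2}\}$ (for $\delta_i\le\frac12$ this just means $t\ge2$), 1. the expected number of active instances of the tester of $i$ after $t$ iterations is at most $C\,\varepsilon_i^{-2}\delta_i^{-1}\log(t\log(1/\delta_i))$; 2. the expected total time spent running configuration $i$ during the first $t$ iterations is at most $C\,R(i^*)\,\varepsilon_i^{-2}\delta_i^{-1}\log(t\log(1/\delta_i))$. -/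

import Mathlib

open MeasureTheory ProbabilityTheory
open scoped ENNReal

universe u v w

noncomputable section

/-- An algorithm configuration problem: a family `N` of configurations, a probability distribution
`Γ` over instances (input, seed), the execution times `R i j`, and a constant `κ₀ > 0` that bounds
all execution times from below. -/
structure ConfigProblem (N J : Type*) [MeasurableSpace J] where
  Γ : Measure J
  isProb : IsProbabilityMeasure Γ
  R : N → J → ℝ
  measurable_R : ∀ i, Measurable (R i)
  κ₀ : ℝ
  κ₀_pos : 0 < κ₀
  κ₀_le : ∀ i j, κ₀ ≤ R i j

namespace ConfigProblem

variable {N J : Type*} [MeasurableSpace J] (p : ConfigProblem N J)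

/-- The average running time `R_θ(i) = E_j[min(R(i,j), θ)]` capped at `θ`. -/
def cappedMean (i : N) (θ : ℝ) : ℝ≥0∞ := ∫⁻ j, ENNReal.ofReal (min (p.R i j) θ) ∂p.Γ

/-- The expected running time `R(i) = E_j[R(i,j)]`, possibly `∞`. -/
def meanRuntime (i : N) : ℝ≥0∞ := ∫⁻ j, ENNReal.ofReal (p.R i j) ∂p.Γ

/-- `OPT`, the infimum (the minimum if `N` is finite and nonempty) of `R(i)`. -/
def OPT : ℝ≥0∞ := ⨅ i, p.meanRuntime i

/-- `i` is an optimal configuration. -/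
def IsOptimal (i : N) : Prop := p.meanRuntime i = p.OPT

/-- `i` is `(ε, δ)`-optimal. -/
def IsEpsDeltaOptimal (i : N) (ε δ : ℝ) : Prop :=
  ∃ θ : ℝ, 0 < θ ∧ p.cappedMean i θ ≤ ENNReal.ofReal (1 + ε) * p.OPT ∧
    p.Γ {j | θ < p.R i j} ≤ ENNReal.ofReal δ

/-- `i` is `(ε, δ)`-suboptimal. -/
def IsEpsDeltaSuboptimal (i : N) (ε δ : ℝ) : Prop := ¬ p.IsEpsDeltaOptimal i ε δ

end ConfigProblem

namespace SPC

/-- `ε(k, r, t) = √(9 · 2 ^ k · ln (k t) / r)`, used for `k, r, t ≥ 1`. -/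
def epsLevel (k r t : ℕ) : ℝ := Real.sqrt (9 * 2 ^ k * Real.log (k * t) / r)

/-- The level `k ≥ 1` of `p ∈ (0, 1]`: the `k` with `2 ^ (-k) < p ≤ 2 ^ (1 - k)`. -/
def level (p : ℝ) : ℕ := ⌊Real.logb 2 (1 / p)⌋₊ + 1

open Classical in
/-- The scaled-down version `β(p, r, t)` of `p ∈ [0, 1]`. For `r = 0`, where `ε(k, r, t) = ∞`,
it is `0`. -/
def beta (p : ℝ) (r t : ℕ) : ℝ :=
  if 0 < r ∧ epsLevel (level p) r t ≤ 1 / 2 then p / (1 + epsLevel (level p) r t) else 0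

/-- `L(G, r, t) = ∫₀^∞ β(1 - G(x), r, t) dx`. -/
def lowerBound (G : ℝ → ℝ) (r t : ℕ) : ℝ := ∫ x in Set.Ioi (0 : ℝ), beta (1 - G x) r t

/-- The queue size `q(r, t) = ⌈50 log₂ (t log₂ r)⌉`, with `log₂ r` replaced by `1` if it is smaller
than `1` (that is, for `r ≤ 1`), and at least `1`. -/
def queueSize (r t : ℕ) : ℕ := max 1 ⌈50 * Real.logb 2 (t * max 1 (Real.logb 2 r))⌉₊

/-- The state of a configuration tester. The instances of its stream are numbered `0, 1, 2, …`. -/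
structure TesterState where
  /-- the number of active instances; these are the instances `0, …, numActive - 1` -/
  numActive : ℕ
  /-- the current timeout threshold `θ` -/
  θ : ℝ
  /-- the pending instances, each with the timeout for its next run; the head is the first entry -/
  queue : List (ℕ × ℝ)
  /-- for each active instance the outcome of its most recent run: the running time if that run
  terminated, and otherwise its timeout -/
  obs : ℕ → ℝ
  /-- the total time spent so far on runs of this configuration -/
  time : ℝ

namespace TesterState

/-- The state of a new configuration tester. -/
def init (κ₀ : ℝ) : TesterState where
  numActive := 0
  θ := κ₀
  queue := []
  obs := fun _ => 0
  time := 0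

open Classical in
/-- Run the configuration on instance `l` with timeout `θ`, where `x l` is the execution time on
instance `l`. If the run times out, the instance goes to the tail of the queue with timeout
`2 θ`. -/
def run (x : ℕ → ℝ) (l : ℕ) (θ : ℝ) (s : TesterState) : TesterState where
  numActive := s.numActive
  θ := θ
  queue := if x l ≤ θ then s.queue else s.queue ++ [(l, 2 * θ)]
  obs := Function.update s.obs l (min (x l) θ)
  time := s.time + min (x l) θ

/-- Activate the first inactive instance of the stream and run it with timeout `s.θ`. -/
def runNew (x : ℕ → ℝ) (s : TesterState) : TesterState :=
  run x s.numActive s.θ { s with numActive := s.numActive + 1 }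

/-- One step of the tester in iteration `t`: replenish the queue if it has fewer than
`q(r, t)` entries, and otherwise run the pending instance at its head. -/
def step (x : ℕ → ℝ) (t : ℕ) (s : TesterState) : TesterState :=
  if s.queue.length < queueSize s.numActive t then s.runNew x
  else match s.queue with
    | [] => s.runNew x -- impossible, since `queueSize` is positive
    | (l, θ') :: Q => run x l θ' { s with queue := Q }

/-- The empirical distribution function of the observed running times of the active instances. -/
def empCDF (s : TesterState) (x : ℝ) : ℝ :=
  (Nat.card {l : Fin s.numActive // s.obs l ≤ x} : ℝ) / s.numActive

/-- The lower confidence bound that the tester reports in iteration `t`; it is `0` as long as there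
are no active instances. -/
def lcb (s : TesterState) (t : ℕ) : ℝ := lowerBound s.empCDF s.numActive t

end TesterState

open Classical in
/-- The states of all testers after `t` iterations, if `x k l` is the execution time of
configuration `k` on instance `l` of its stream, and `a t` is the configuration that the scheduler
selects in iteration `t + 1`. -/
def states {N : Type*} (κ₀ : ℝ) (x : N → ℕ → ℝ) (a : ℕ → N) : ℕ → N → TesterState
  | 0 => fun _ => TesterState.init κ₀
  | t + 1 => fun k =>
      if k = a t then (states κ₀ x a t k).step (x k) (t + 1) else states κ₀ x a t k

/-- `a` is a sequence of selections made by the scheduler of Structured Procrastination with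
Confidence: in each iteration `t + 1` it selects a configuration with the least lower confidence
bound (ties may be broken in any way). -/
def IsRun {N : Type*} (κ₀ : ℝ) (x : N → ℕ → ℝ) (a : ℕ → N) : Prop :=
  ∀ (t : ℕ) (k : N),
    (states κ₀ x a t (a t)).lcb (t + 1) ≤ (states κ₀ x a t k).lcb (t + 1)

/-- `B(t, ε, δ) = ε⁻² δ⁻¹ log₂ (t log₂ (1 / δ))`. -/
def bound (t : ℕ) (ε δ : ℝ) : ℝ :=
  (ε ^ 2)⁻¹ * δ⁻¹ * Real.logb 2 (t * Real.logb 2 (1 / δ))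

end SPC

end

/-! ### Levels, confidence widths and the scaled-down probability `beta` -/

namespace SPC

/-! Configuration i is run only when its lower confidence bound is at most that of i*. Two deviation
estimates limit how often this can happen, and a deterministic analysis of the queue turns bounds on
activations into bounds on time.

Upper side. In iteration s the bound of i* is at most R(i*) unless some empirical tail exceeds the
true tail by more than the factor 1 + `width`. For a sample size r and a count m this is covered by
one event, `Overshoot`, whose Chernoff bound is s^(-12/5), and s^(-17/5) if the width is at most
1/5. The union over all m ≤ r ≤ s has probability O(s^(-6/5)) (`sum_exp_neg_rate_le`), which is
summable. Since all sample sizes are covered, neither the dependence of the scheduler on the samples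
nor that between different streams matters.

Lower side. Let q be a δ-quantile of the running time of i and M its mean capped at q. Suboptimality
forces M > (1 + ε) R(i*), and M ≥ qδ. Hence r ≥ 2592 ε⁻² δ⁻¹ ln s samples represent both M and the
mass above q up to a factor 1 - ε/6, with failure probabilities summable in r. Recorded outcomes are
too small only for pending instances, of which there are O(log s), few compared with εδr. So the
bound of i exceeds R(i*) (`Inv.le_lcb`, `lt_shrink_mul`), and i is not selected. Every activation
beyond the threshold is thus charged to a bad iteration or a bad sample size
(`numActive_states_le_of_charge`); the expected number K of charges is O(1).

Time. Timeouts double, so the time is at most three times the sum of the recorded outcomes. That sum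
and the current timeout are controlled by r times the bound of i (`Inv.sum_obs_le`,
`Inv.head_mul_queueSize_le`), which at selection times is at most the bound of i*. The latter may be
large on rare events; this is measured by a random variable W, `excess`, with bounded expectation.
The resulting estimate is linear in K and W (`time_states_le`), so no expectation of a product is
needed. -/

theorem one_le_level (p : ℝ) : 1 ≤ level p := Nat.le_add_left _ _

theorem two_pow_level_le {p : ℝ} (h0 : 0 < p) (h1 : p ≤ 1) : (2 : ℝ) ^ level p ≤ 2 / p := by
  have h : (0 : ℝ) ≤ Real.logb 2 (1 / p) :=
    Real.logb_nonneg (by norm_num) ((one_le_div h0).2 h1)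
  have h2 : (2 : ℝ) ^ (⌊Real.logb 2 (1 / p)⌋₊ : ℝ) ≤ 1 / p := by
    rw [← Real.le_logb_iff_rpow_le (by norm_num) (by positivity)]
    exact Nat.floor_le h
  rw [Real.rpow_natCast] at h2
  calc (2 : ℝ) ^ level p = 2 ^ ⌊Real.logb 2 (1 / p)⌋₊ * 2 := by rw [level, pow_succ]
    _ ≤ 1 / p * 2 := by gcongr
    _ = 2 / p := by ring

theorem one_div_lt_two_pow_level {p : ℝ} (h0 : 0 < p) : 1 / p < (2 : ℝ) ^ level p := by
  rw [← Real.rpow_natCast, ← Real.logb_lt_iff_lt_rpow (by norm_num) (by positivity)]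
  rw [level]; push_cast
  exact Nat.lt_floor_add_one _

theorem level_anti {p p' : ℝ} (h0 : 0 < p) (h : p ≤ p') : level p' ≤ level p := by
  unfold level
  gcongr
  · norm_num
  · exact one_div_pos.2 (h0.trans_le h)

theorem epsLevel_nonneg (k r t : ℕ) : 0 ≤ epsLevel k r t := Real.sqrt_nonneg _

theorem log_level_nonneg (k t : ℕ) : 0 ≤ Real.log ((k : ℝ) * t) := by
  exact_mod_cast Real.log_natCast_nonneg (k * t)

theorem epsLevel_sq (k r t : ℕ) : epsLevel k r t ^ 2 = 9 * 2 ^ k * Real.log (k * t) / r :=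
  Real.sq_sqrt (by have := log_level_nonneg k t; positivity)

theorem epsLevel_mono {k k' : ℕ} (hk : 1 ≤ k) (h : k ≤ k') (r : ℕ) {t : ℕ} (ht : 1 ≤ t) :
    epsLevel k r t ≤ epsLevel k' r t := by
  have hk' : (0 : ℝ) < (k : ℝ) * t := by positivity
  have := log_level_nonneg k t
  unfold epsLevel
  gcongr
  norm_num

theorem beta_nonneg {p : ℝ} (h : 0 ≤ p) (r t : ℕ) : 0 ≤ beta p r t := by
  unfold beta
  have := epsLevel_nonneg (level p) r t
  split_ifs <;> positivity

theorem beta_le {p : ℝ} (h : 0 ≤ p) (r t : ℕ) : beta p r t ≤ p := by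
  unfold beta
  have := epsLevel_nonneg (level p) r t
  split_ifs
  · exact div_le_self h (by linarith)
  · exact h

theorem beta_zero (r t : ℕ) : beta 0 r t = 0 := by simp [beta]

theorem beta_zero_active (p : ℝ) (t : ℕ) : beta p 0 t = 0 := by simp [beta]

/-- A larger probability has a lower level and hence a smaller width, so both the cutoff and the
denominator favour it. This makes the confidence bound monotone in the sample. -/
theorem beta_mono {p p' : ℝ} (h0 : 0 ≤ p) (h : p ≤ p') (r : ℕ) {t : ℕ} (ht : 1 ≤ t) :
    beta p r t ≤ beta p' r t := by
  rcases h0.eq_or_lt with rfl | h0'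
  · rw [beta_zero]; exact beta_nonneg h _ _
  have hl := epsLevel_mono (one_le_level p') (level_anti h0' h) r ht
  by_cases hc : 0 < r ∧ epsLevel (level p) r t ≤ 1 / 2
  · have hc' : 0 < r ∧ epsLevel (level p') r t ≤ 1 / 2 := ⟨hc.1, hl.trans hc.2⟩
    rw [beta, beta, if_pos hc, if_pos hc']
    have := epsLevel_nonneg (level p') r t
    gcongr
    exact h0.trans h
  · rw [beta, if_neg hc]
    exact beta_nonneg (h0.trans h) _ _

/-- The confidence width at the empirical frequency `m / r`. -/
noncomputable def width (m r t : ℕ) : ℝ := epsLevel (level ((m : ℝ) / r)) r t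

theorem width_nonneg (m r t : ℕ) : 0 ≤ width m r t := epsLevel_nonneg _ _ _

/-- Up to a factor 2, the power `2 ^ k` in `epsLevel` is r / m. Hence m times the squared width is
logarithmic; the matching lower bound is `le_width_sq`. -/
theorem width_sq_le {m r t : ℕ} (hm : 1 ≤ m) (hmr : m ≤ r) :
    m * width m r t ^ 2 ≤ 18 * Real.log (level ((m : ℝ) / r) * t) := by
  have hm' : (0 : ℝ) < m := by exact_mod_cast hm
  have hr' : (0 : ℝ) < r := by exact_mod_cast hm.trans hmr
  have h1 := two_pow_level_le (p := (m : ℝ) / r) (by positivity)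
    ((div_le_one hr').2 (by exact_mod_cast hmr))
  rw [width, epsLevel_sq]
  have h2 := log_level_nonneg (level ((m : ℝ) / r)) t
  calc _ = (m * 2 ^ level ((m : ℝ) / r)) * (9 * Real.log (level ((m : ℝ) / r) * t)) / r := by ring
    _ ≤ (m * (2 / (m / r))) * (9 * Real.log (level ((m : ℝ) / r) * t)) / r := by gcongr
    _ = _ := by field_simp; ring

theorem le_width_sq {m r : ℕ} (t : ℕ) (hm : 1 ≤ m) (hmr : m ≤ r) :
    9 * Real.log (level ((m : ℝ) / r) * t) ≤ m * width m r t ^ 2 := by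
  have hm' : (0 : ℝ) < m := by exact_mod_cast hm
  have hr' : (0 : ℝ) < r := by exact_mod_cast hm.trans hmr
  have h1 := (one_div_lt_two_pow_level (p := (m : ℝ) / r) (by positivity)).le
  rw [width, epsLevel_sq]
  have h2 := log_level_nonneg (level ((m : ℝ) / r)) t
  calc _ = (m * (1 / (m / r))) * (9 * Real.log (level ((m : ℝ) / r) * t)) / r := by field_simp
    _ ≤ (m * 2 ^ level ((m : ℝ) / r)) * (9 * Real.log (level ((m : ℝ) / r) * t)) / r := by gcongr
    _ = _ := by ring

theorem log_le_width_sq {m r t : ℕ} (ht : 1 ≤ t) (hm : 1 ≤ m) (hmr : m ≤ r) :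
    9 * Real.log t ≤ m * width m r t ^ 2 := by
  refine le_trans ?_ (le_width_sq t hm hmr)
  have : (1 : ℝ) ≤ level ((m : ℝ) / r) := by exact_mod_cast one_le_level _
  have ht' : (1 : ℝ) ≤ t := by exact_mod_cast ht
  gcongr
  nlinarith

/-- Since 2 ^ k ≤ 2 r / m, a count of at least 2 brings the level below log₂ r, the quantity that
appears in `queueSize`. -/
theorem level_le_logb {m r : ℕ} (hm : 2 ≤ m) (hmr : m ≤ r) :
    (level ((m : ℝ) / r) : ℝ) ≤ Real.logb 2 r := by
  have hm' : (2 : ℝ) ≤ m := by exact_mod_cast hm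
  have hr' : (2 : ℝ) ≤ r := by exact_mod_cast hm.trans hmr
  have h1 := two_pow_level_le (p := (m : ℝ) / r) (by positivity)
    ((div_le_one (by linarith)).2 (by exact_mod_cast hmr))
  rw [Real.le_logb_iff_rpow_le (by norm_num) (by linarith), Real.rpow_natCast]
  refine h1.trans ?_
  rw [div_div_eq_mul_div, div_le_iff₀ (by linarith)]
  nlinarith

theorem logb_two_le_self (r : ℕ) : Real.logb 2 r ≤ r := by
  rcases Nat.eq_zero_or_pos r with rfl | hr
  · simp
  rw [Real.logb_le_iff_le_rpow (by norm_num) (by exact_mod_cast hr), Real.rpow_natCast]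
  exact_mod_cast Nat.lt_two_pow_self.le

/-- If the count `m` is large, then `β (m / r)` is close to `m / r`. -/
theorem le_beta {m r t : ℕ} {η : ℝ} (ht : 1 ≤ t) (hm : 2 ≤ m) (hmr : m ≤ r) (hη : 0 < η)
    (hη' : η ≤ 1 / 2) (h : 18 * Real.log (t * max 1 (Real.logb 2 r)) ≤ η ^ 2 * m) :
    (m : ℝ) / r / (1 + η) ≤ beta (m / r) r t := by
  have hm' : (2 : ℝ) ≤ m := by exact_mod_cast hm
  have ht' : (1 : ℝ) ≤ t := by exact_mod_cast ht
  have h1 := width_sq_le (t := t) (by omega : 1 ≤ m) hmr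
  have hl : (1 : ℝ) ≤ level ((m : ℝ) / r) := by exact_mod_cast one_le_level _
  have h2 : Real.log (level ((m : ℝ) / r) * t) ≤ Real.log (t * max 1 (Real.logb 2 r)) := by
    rw [mul_comm]
    gcongr
    exact (level_le_logb hm hmr).trans (le_max_right _ _)
  have h3 : width m r t ≤ η := by
    refine (sq_le_sq₀ (width_nonneg _ _ _) hη.le).1 ?_
    have : (m : ℝ) * width m r t ^ 2 ≤ m * η ^ 2 := by linarith
    exact le_of_mul_le_mul_left this (by linarith)
  have h0 := width_nonneg m r t
  rw [beta, if_pos ⟨by omega, h3.trans hη'⟩]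
  change _ ≤ _ / (1 + width m r t)
  gcongr

/-! ### Empirical tails and the confidence bound of a sample -/

/-- The number of the first `r` values of `f` that exceed `x`. -/
noncomputable def tailCount (f : ℕ → ℝ) (r : ℕ) (x : ℝ) : ℕ :=
  ((Finset.range r).filter fun l => x < f l).card

theorem tailCount_le (f : ℕ → ℝ) (r : ℕ) (x : ℝ) : tailCount f r x ≤ r :=
  (Finset.card_filter_le _ _).trans (Finset.card_range r).le

theorem tailCount_anti (f : ℕ → ℝ) (r : ℕ) : Antitone (tailCount f r) := fun _ _ h =>
  Finset.card_le_card (Finset.monotone_filter_right _ fun _ _ h' => h.trans_lt h')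

theorem tailCount_mono {f g : ℕ → ℝ} {r : ℕ} (h : ∀ l < r, f l ≤ g l) (x : ℝ) :
    tailCount f r x ≤ tailCount g r x := by
  refine Finset.card_le_card fun l hl => ?_
  simp only [Finset.mem_filter, Finset.mem_range] at hl ⊢
  exact ⟨hl.1, hl.2.trans_le (h l hl.1)⟩

theorem tailCount_eq_sum (f : ℕ → ℝ) (r : ℕ) (x : ℝ) :
    (tailCount f r x : ℝ) = ∑ l ∈ Finset.range r, (Set.Iio (f l)).indicator (fun _ => (1 : ℝ)) x := by
  rw [tailCount, Finset.card_filter, Nat.cast_sum]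
  refine Finset.sum_congr rfl fun l _ => ?_
  by_cases h : x < f l <;> simp [h]

theorem tailCount_eq_zero {f : ℕ → ℝ} {r : ℕ} {x : ℝ} (h : ∀ l < r, f l ≤ x) :
    tailCount f r x = 0 := by
  rw [tailCount, Finset.card_eq_zero, Finset.filter_eq_empty_iff]
  exact fun l hl => not_lt.2 (h l (Finset.mem_range.1 hl))

/-- Layer cake for the empirical distribution: the value `f l` contributes the length of the
interval (0, min (f l) a). -/
theorem setIntegral_tailCount {f : ℕ → ℝ} {r : ℕ} (hf : ∀ l < r, 0 ≤ f l) {a : ℝ} (ha : 0 ≤ a) :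
    ∫ x in Set.Ioo 0 a, (tailCount f r x : ℝ) = ∑ l ∈ Finset.range r, min (f l) a := by
  simp_rw [tailCount_eq_sum]
  have hfin : ∀ l, Set.Iio (f l) ∩ Set.Ioo 0 a = Set.Ioo 0 (min (f l) a) := fun l => by
    ext x; simp only [Set.mem_inter_iff, Set.mem_Iio, Set.mem_Ioo, lt_min_iff]; tauto
  rw [integral_finsetSum]
  · refine Finset.sum_congr rfl fun l hl => ?_
    rw [integral_indicator measurableSet_Iio, Measure.restrict_restrict measurableSet_Iio, hfin]
    have := hf l (Finset.mem_range.1 hl)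
    simp [ha, this]
  · intro l _
    refine IntegrableOn.integrable_indicator ?_ measurableSet_Iio
    rw [integrableOn_const_iff, Measure.restrict_apply measurableSet_Iio, hfin]
    right; simp

theorem integrableOn_tailCount (f : ℕ → ℝ) (r : ℕ) (a : ℝ) :
    IntegrableOn (fun x => (tailCount f r x : ℝ)) (Set.Ioo 0 a) := by
  refine Measure.integrableOn_of_bounded (M := r) (by simp) ?_ ?_
  · refine (Antitone.measurable fun x y h => ?_).aestronglyMeasurable
    exact_mod_cast tailCount_anti f r h
  · refine Filter.Eventually.of_forall fun x => ?_
    rw [Real.norm_natCast]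
    exact_mod_cast tailCount_le f r x

/-- The lower confidence bound computed from the first `r` values of `f`. -/
noncomputable def sampleLcb (f : ℕ → ℝ) (r t : ℕ) : ℝ :=
  ∫ x in Set.Ioi (0 : ℝ), beta ((tailCount f r x : ℝ) / r) r t

theorem beta_tailCount_anti (f : ℕ → ℝ) (r : ℕ) {t : ℕ} (ht : 1 ≤ t) :
    Antitone fun x => beta ((tailCount f r x : ℝ) / r) r t := fun x y h => by
  refine beta_mono (by positivity) ?_ r ht
  have := tailCount_anti f r h
  gcongr

theorem integrable_beta_tailCount (f : ℕ → ℝ) (r : ℕ) {t : ℕ} (ht : 1 ≤ t) :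
    IntegrableOn (fun x => beta ((tailCount f r x : ℝ) / r) r t) (Set.Ioi 0) := by
  set M := ∑ l ∈ Finset.range r, |f l| with hM
  have hb : ∀ l < r, f l ≤ M := fun l hl => (le_abs_self _).trans
    (Finset.single_le_sum (f := fun l => |f l|) (fun _ _ => abs_nonneg _) (Finset.mem_range.2 hl))
  have h1 : IntegrableOn (fun x => beta ((tailCount f r x : ℝ) / r) r t) (Set.Ioc 0 M) := by
    refine Measure.integrableOn_of_bounded (M := 1) (by simp)
      (beta_tailCount_anti f r ht).measurable.aestronglyMeasurable ?_
    refine Filter.Eventually.of_forall fun x => ?_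
    have h0 : (0 : ℝ) ≤ (tailCount f r x : ℝ) / r := by positivity
    rw [Real.norm_of_nonneg (beta_nonneg h0 _ _)]
    refine (beta_le h0 _ _).trans (div_le_one_of_le₀ ?_ (by positivity))
    exact_mod_cast tailCount_le f r x
  have h2 : IntegrableOn (fun x => beta ((tailCount f r x : ℝ) / r) r t) (Set.Ioi M) := by
    refine IntegrableOn.congr_fun (f := fun _ => (0 : ℝ)) integrableOn_zero (fun x hx => ?_)
      measurableSet_Ioi
    simp [tailCount_eq_zero fun l hl => (hb l hl).trans (le_of_lt hx), beta_zero]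
  have hM0 : 0 ≤ M := Finset.sum_nonneg fun _ _ => abs_nonneg _
  have := h1.union h2
  rwa [Set.Ioc_union_Ioi_eq_Ioi hM0] at this

theorem sampleLcb_zero (f : ℕ → ℝ) (t : ℕ) : sampleLcb f 0 t = 0 := by
  simp [sampleLcb, beta_zero]

theorem sampleLcb_mono {f g : ℕ → ℝ} {r t : ℕ} (ht : 1 ≤ t) (h : ∀ l < r, f l ≤ g l) :
    sampleLcb f r t ≤ sampleLcb g r t := by
  refine integral_mono (integrable_beta_tailCount f r ht) (integrable_beta_tailCount g r ht)
    fun x => beta_mono (by positivity) ?_ r ht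
  have := tailCount_mono h x
  gcongr

theorem setIntegral_le_sampleLcb (f : ℕ → ℝ) (r : ℕ) {t : ℕ} (ht : 1 ≤ t) (a : ℝ) {g : ℝ → ℝ}
    (hg : IntegrableOn g (Set.Ioo 0 a))
    (h : ∀ x ∈ Set.Ioo 0 a, g x ≤ beta ((tailCount f r x : ℝ) / r) r t) :
    ∫ x in Set.Ioo 0 a, g x ≤ sampleLcb f r t := by
  have hi := integrable_beta_tailCount f r ht
  calc _ ≤ ∫ x in Set.Ioo 0 a, beta ((tailCount f r x : ℝ) / r) r t :=
        setIntegral_mono_on hg (hi.mono_set Set.Ioo_subset_Ioi_self) measurableSet_Ioo h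
    _ ≤ _ := setIntegral_mono_set hi
        (Filter.Eventually.of_forall fun x => beta_nonneg (by positivity) _ _)
        Set.Ioo_subset_Ioi_self.eventuallyLE

theorem ofReal_sampleLcb (f : ℕ → ℝ) (r : ℕ) {t : ℕ} (ht : 1 ≤ t) :
    ENNReal.ofReal (sampleLcb f r t) =
      ∫⁻ x in Set.Ioi (0 : ℝ), ENNReal.ofReal (beta ((tailCount f r x : ℝ) / r) r t) :=
  ofReal_integral_eq_lintegral_ofReal (integrable_beta_tailCount f r ht)
    (Filter.Eventually.of_forall fun x => beta_nonneg (by positivity) _ _)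

namespace TesterState

theorem one_sub_empCDF (s : TesterState) (h : 0 < s.numActive) (x : ℝ) :
    1 - s.empCDF x = (tailCount s.obs s.numActive x : ℝ) / s.numActive := by
  have h1 : Nat.card {l : Fin s.numActive // s.obs l ≤ x} =
      ((Finset.range s.numActive).filter fun l => ¬ x < s.obs l).card := by
    rw [← Fintype.card_coe, ← Nat.card_eq_fintype_card]
    refine Nat.card_congr ⟨fun l => ⟨l.1, ?_⟩, fun l => ⟨⟨l.1, ?_⟩, ?_⟩, fun _ => rfl, fun _ => rfl⟩
    · exact Finset.mem_filter.2 ⟨Finset.mem_range.2 l.1.2, not_lt.2 l.2⟩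
    · exact Finset.mem_range.1 (Finset.mem_filter.1 l.2).1
    · exact not_lt.1 (Finset.mem_filter.1 l.2).2
  have h2 := Finset.card_filter_add_card_filter_not (s := Finset.range s.numActive)
    (fun l => x < s.obs l)
  rw [← h1, Finset.card_range] at h2
  rw [empCDF, tailCount]
  have h3 : (s.numActive : ℝ) ≠ 0 := by positivity
  rw [eq_div_iff h3, sub_mul, div_mul_cancel₀ _ h3, one_mul, sub_eq_iff_eq_add]
  exact_mod_cast h2.symm

theorem lcb_eq (s : TesterState) (t : ℕ) : s.lcb t = sampleLcb s.obs s.numActive t := by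
  rcases Nat.eq_zero_or_pos s.numActive with h | h
  · rw [h, sampleLcb_zero, lcb, lowerBound, h]
    simp [beta_zero_active]
  · simp_rw [lcb, lowerBound, sampleLcb, s.one_sub_empCDF h]

end TesterState

/-! ### Invariants of a configuration tester -/

namespace TesterState

/-- A bound on the total time spent on an instance with outcome `o` of the most recent run and
running time `x`: the timeouts of its runs form a geometric series. -/
noncomputable def instanceCost (o x : ℝ) : ℝ := if o < x then 2 * o else 3 * o

theorem instanceCost_le {o : ℝ} (x : ℝ) (h : 0 ≤ o) : instanceCost o x ≤ 3 * o := by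
  unfold instanceCost; split_ifs <;> linarith

/-- The invariants of a configuration tester. -/
structure Inv (κ₀ : ℝ) (x : ℕ → ℝ) (s : TesterState) : Prop where
  le_θ : κ₀ ≤ s.θ
  obs_pos : ∀ l < s.numActive, 0 < s.obs l
  obs_le : ∀ l < s.numActive, s.obs l ≤ x l
  obs_le_θ : ∀ l < s.numActive, s.obs l ≤ s.θ
  pending : ∀ l < s.numActive, s.obs l < x l → l ∈ s.queue.map Prod.fst
  queue_spec : ∀ e ∈ s.queue, e.1 < s.numActive ∧ e.2 = 2 * s.obs e.1 ∧ s.obs e.1 < x e.1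
  nodup : (s.queue.map Prod.fst).Nodup
  sorted : ∃ A B, s.queue = A ++ B ∧ (∀ e ∈ A, e.2 = s.θ) ∧ ∀ e ∈ B, e.2 = 2 * s.θ
  time_le : s.time ≤ ∑ l ∈ Finset.range s.numActive, instanceCost (s.obs l) (x l)

theorem inv_init (κ₀ : ℝ) (x : ℕ → ℝ) : (init κ₀).Inv κ₀ x where
  le_θ := le_rfl
  obs_pos l h := absurd h (Nat.not_lt_zero l)
  obs_le l h := absurd h (Nat.not_lt_zero l)
  obs_le_θ l h := absurd h (Nat.not_lt_zero l)
  pending l h := absurd h (Nat.not_lt_zero l)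
  queue_spec e h := absurd h List.not_mem_nil
  nodup := List.nodup_nil
  sorted := ⟨[], [], rfl, by simp, by simp⟩
  time_le := by simp [init]

variable {κ₀ : ℝ} {x : ℕ → ℝ} {s : TesterState}

theorem run_obs_self (l : ℕ) (θ : ℝ) : (run x l θ s).obs l = min (x l) θ :=
  Function.update_self _ _ _

theorem run_obs_of_ne {l l' : ℕ} (θ : ℝ) (h : l' ≠ l) : (run x l θ s).obs l' = s.obs l' :=
  Function.update_of_ne h _ _

/-- Common part of both kinds of step. The invariants are required only away from `l`, whose record
is overwritten. `v` bounds the time already spent on `l`: 0 for a new instance, and θ for a popped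
one, whose last timeout was θ / 2. -/
theorem inv_run (hκ : 0 < κ₀) {l : ℕ} {θ v : ℝ} (hx : κ₀ ≤ x l) (hl : l < s.numActive)
    (hθ : κ₀ ≤ θ)
    (obs_pos : ∀ l' < s.numActive, l' ≠ l → 0 < s.obs l')
    (obs_le : ∀ l' < s.numActive, l' ≠ l → s.obs l' ≤ x l')
    (obs_le_θ : ∀ l' < s.numActive, l' ≠ l → s.obs l' ≤ θ)
    (pending : ∀ l' < s.numActive, l' ≠ l → s.obs l' < x l' → l' ∈ s.queue.map Prod.fst)
    (queue_spec : ∀ e ∈ s.queue,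
      e.1 ≠ l ∧ e.1 < s.numActive ∧ e.2 = 2 * s.obs e.1 ∧ s.obs e.1 < x e.1)
    (nodup : (s.queue.map Prod.fst).Nodup)
    (sorted : ∃ A B, s.queue = A ++ B ∧ (∀ e ∈ A, e.2 = θ) ∧ ∀ e ∈ B, e.2 = 2 * θ)
    (time_le : s.time ≤
      (∑ l' ∈ (Finset.range s.numActive).erase l, instanceCost (s.obs l') (x l')) + v)
    (hv : v ≤ θ) (hvx : v ≤ 2 * x l) : (run x l θ s).Inv κ₀ x where
  le_θ := hθ
  obs_pos l' h := by
    by_cases e : l' = l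
    · subst e; rw [run_obs_self]; exact lt_min (hκ.trans_le hx) (hκ.trans_le hθ)
    · rw [run_obs_of_ne _ e]; exact obs_pos l' h e
  obs_le l' h := by
    by_cases e : l' = l
    · subst e; rw [run_obs_self]; exact min_le_left _ _
    · rw [run_obs_of_ne _ e]; exact obs_le l' h e
  obs_le_θ l' h := by
    by_cases e : l' = l
    · subst e; rw [run_obs_self]; exact min_le_right _ _
    · rw [run_obs_of_ne _ e]; exact obs_le_θ l' h e
  pending l' h hlt := by
    by_cases e : l' = l
    · subst e
      rw [run_obs_self, min_lt_iff, or_iff_right (lt_irrefl _)] at hlt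
      simp [run, not_le.2 hlt]
    · rw [run_obs_of_ne _ e] at hlt
      have := pending l' h e hlt
      simp only [run]
      split_ifs
      · exact this
      · rw [List.map_append]; exact List.mem_append_left _ this
  queue_spec e he := by
    by_cases h : x l ≤ θ
    · simp only [run, if_pos h] at he
      obtain ⟨h1, h2, h3, h4⟩ := queue_spec e he
      rw [run_obs_of_ne _ h1]
      exact ⟨h2, h3, h4⟩
    · simp only [run, if_neg h, List.mem_append, List.mem_singleton] at he
      rcases he with he | rfl
      · obtain ⟨h1, h2, h3, h4⟩ := queue_spec e he
        rw [run_obs_of_ne _ h1]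
        exact ⟨h2, h3, h4⟩
      · rw [run_obs_self, min_eq_right (not_le.1 h).le]
        exact ⟨hl, rfl, not_le.1 h⟩
  nodup := by
    simp only [run]
    split_ifs
    · exact nodup
    · rw [List.map_append, List.nodup_append]
      refine ⟨nodup, by simp, fun a ha b hb => ?_⟩
      obtain ⟨e, he, rfl⟩ := List.mem_map.1 ha
      simp only [List.map_cons, List.map_nil, List.mem_singleton] at hb
      rw [hb]; exact (queue_spec e he).1
  sorted := by
    obtain ⟨A, B, h1, h2, h3⟩ := sorted
    simp only [run]
    split_ifs
    · exact ⟨A, B, h1, h2, h3⟩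
    · refine ⟨A, B ++ [(l, 2 * θ)], by rw [h1, List.append_assoc], h2, fun e he => ?_⟩
      rcases List.mem_append.1 he with he | he
      · exact h3 e he
      · rw [List.mem_singleton.1 he]
  time_le := by
    change s.time + min (x l) θ ≤ ∑ l' ∈ Finset.range s.numActive, _
    rw [← Finset.sum_erase_add _ _ (Finset.mem_range.2 hl), run_obs_self]
    have h1 : ∑ l' ∈ (Finset.range s.numActive).erase l,
        instanceCost ((run x l θ s).obs l') (x l') =
        ∑ l' ∈ (Finset.range s.numActive).erase l, instanceCost (s.obs l') (x l') :=
      Finset.sum_congr rfl fun l' h => by rw [run_obs_of_ne _ (Finset.ne_of_mem_erase h)]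
    rw [h1]
    -- A finished run adds x to at most 2 x, an unfinished one adds θ to at most θ.
    have h2 : v + min (x l) θ ≤ instanceCost (min (x l) θ) (x l) := by
      unfold instanceCost
      rcases le_or_gt (x l) θ with h | h
      · rw [min_eq_left h, if_neg (lt_irrefl _)]; linarith
      · rw [min_eq_right h.le, if_pos h]; linarith
    linarith

theorem Inv.runNew (h : s.Inv κ₀ x) (hκ : 0 < κ₀) (hx : ∀ l, κ₀ ≤ x l) :
    (s.runNew x).Inv κ₀ x := by
  have hlt : ∀ l' < s.numActive + 1, l' ≠ s.numActive → l' < s.numActive := by omega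
  refine inv_run (v := 0) hκ (hx _) (Nat.lt_succ_self _) h.le_θ
    (fun l' h1 h2 => h.obs_pos l' (hlt l' h1 h2)) (fun l' h1 h2 => h.obs_le l' (hlt l' h1 h2))
    (fun l' h1 h2 => h.obs_le_θ l' (hlt l' h1 h2)) (fun l' h1 h2 => h.pending l' (hlt l' h1 h2))
    (fun e he => ?_) h.nodup h.sorted ?_ (hκ.le.trans h.le_θ)
    (by have := hx s.numActive; linarith)
  · obtain ⟨h1, h2, h3⟩ := h.queue_spec e he
    exact ⟨h1.ne, Nat.lt_succ_of_lt h1, h2, h3⟩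
  · have : (Finset.range (s.numActive + 1)).erase s.numActive = Finset.range s.numActive := by
      rw [Finset.range_add_one, Finset.erase_insert Finset.notMem_range_self]
    simpa only [this, add_zero] using h.time_le

/-- The queue is a block with timeout θ followed by a block with timeout 2 θ. When the first block
is exhausted, the head doubles θ and the second block becomes the first. -/
theorem Inv.head_spec (h : s.Inv κ₀ x) (hκ : 0 < κ₀) {l : ℕ} {θ : ℝ} {Q : List (ℕ × ℝ)}
    (hQ : s.queue = (l, θ) :: Q) :
    s.θ ≤ θ ∧ (∀ e ∈ Q, θ ≤ e.2) ∧
      ∃ A B, Q = A ++ B ∧ (∀ e ∈ A, e.2 = θ) ∧ ∀ e ∈ B, e.2 = 2 * θ := by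
  have hθ := hκ.trans_le h.le_θ
  obtain ⟨A, B, h1, h2, h3⟩ := h.sorted
  rw [hQ] at h1
  cases A with
  | nil =>
    rw [List.nil_append] at h1
    have hθ' : θ = 2 * s.θ := h3 (l, θ) (h1 ▸ List.mem_cons_self)
    have hQ' : ∀ e ∈ Q, e.2 = θ := fun e he => hθ' ▸ h3 e (h1 ▸ List.mem_cons_of_mem _ he)
    exact ⟨by linarith, fun e he => (hQ' e he).ge, Q, [], by simp, hQ', by simp⟩
  | cons a A =>
    rw [List.cons_append, List.cons.injEq] at h1
    have hθ' : θ = s.θ := by rw [← h2 a List.mem_cons_self, ← h1.1]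
    refine ⟨hθ'.ge, fun e he => ?_, A, B, h1.2,
      fun e he => hθ' ▸ h2 e (List.mem_cons_of_mem _ he), hθ' ▸ h3⟩
    rw [h1.2, List.mem_append] at he
    rcases he with he | he
    · rw [h2 e (List.mem_cons_of_mem _ he), hθ']
    · rw [h3 e he]; linarith

theorem Inv.pop (h : s.Inv κ₀ x) (hκ : 0 < κ₀) (hx : ∀ l, κ₀ ≤ x l) {l : ℕ} {θ : ℝ}
    {Q : List (ℕ × ℝ)} (hQ : s.queue = (l, θ) :: Q) :
    (run x l θ { s with queue := Q }).Inv κ₀ x := by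
  obtain ⟨hθ, -, hsort⟩ := h.head_spec hκ hQ
  obtain ⟨hl, hlθ, hlx⟩ := h.queue_spec (l, θ) (hQ ▸ List.mem_cons_self)
  simp only at hl hlθ hlx
  have hnd := h.nodup
  rw [hQ, List.map_cons, List.nodup_cons] at hnd
  refine inv_run (v := θ) hκ (hx _) hl (h.le_θ.trans hθ)
    (fun l' h1 _ => h.obs_pos l' h1) (fun l' h1 _ => h.obs_le l' h1)
    (fun l' h1 _ => (h.obs_le_θ l' h1).trans hθ) (fun l' h1 h2 h3 => ?_)
    (fun e he => ⟨?_, h.queue_spec e (hQ ▸ List.mem_cons_of_mem _ he)⟩) hnd.2 hsort ?_ le_rfl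
    (by linarith)
  · have := h.pending l' h1 h3
    rw [hQ, List.map_cons, List.mem_cons] at this
    exact this.resolve_left h2
  · rintro rfl
    exact hnd.1 (List.mem_map.2 ⟨e, he, rfl⟩)
  · have := h.time_le
    rw [← Finset.sum_erase_add _ _ (Finset.mem_range.2 hl)] at this
    refine this.trans (add_le_add le_rfl ?_)
    rw [instanceCost, if_pos hlx, hlθ]

theorem queueSize_pos (r t : ℕ) : 0 < queueSize r t := Nat.lt_of_lt_of_le one_pos (le_max_left _ _)

/-- A step either activates a new instance or runs the head of a full queue. -/
theorem step_cases (x : ℕ → ℝ) (t : ℕ) (s : TesterState) :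
    (s.queue.length < queueSize s.numActive t ∧ s.step x t = s.runNew x) ∨
      ∃ l θ Q, s.queue = (l, θ) :: Q ∧ queueSize s.numActive t ≤ s.queue.length ∧
        s.step x t = run x l θ { s with queue := Q } := by
  unfold step
  split_ifs with h
  · exact Or.inl ⟨h, rfl⟩
  · rcases hq : s.queue with _ | ⟨⟨l, θ⟩, Q⟩
    · rw [hq] at h
      exact absurd (queueSize_pos _ _) h
    · exact Or.inr ⟨l, θ, Q, rfl, hq ▸ not_lt.1 h, rfl⟩

theorem Inv.step (h : s.Inv κ₀ x) (hκ : 0 < κ₀) (hx : ∀ l, κ₀ ≤ x l) (t : ℕ) :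
    (s.step x t).Inv κ₀ x := by
  rcases step_cases x t s with ⟨-, h1⟩ | ⟨l, θ, Q, hQ, -, h1⟩ <;> rw [h1]
  · exact h.runNew hκ hx
  · exact h.pop hκ hx hQ

theorem length_run_le (x : ℕ → ℝ) (l : ℕ) (θ : ℝ) (s : TesterState) :
    (run x l θ s).queue.length ≤ s.queue.length + 1 := by
  simp only [run]; split_ifs <;> simp

/-- Only pending instances are counted wrongly by the observed running times. -/
theorem Inv.tailCount_le (h : s.Inv κ₀ x) (y : ℝ) :
    tailCount x s.numActive y ≤ tailCount s.obs s.numActive y + s.queue.length := by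
  rw [← List.length_map (f := Prod.fst), ← List.toFinset_card_of_nodup h.nodup]
  refine le_trans (Finset.card_le_card fun l hl => ?_) (Finset.card_union_le _ _)
  simp only [Finset.mem_filter, Finset.mem_range, Finset.mem_union, List.mem_toFinset] at hl ⊢
  by_cases ho : s.obs l < x l
  · exact Or.inr (h.pending l hl.1 ho)
  · exact Or.inl ⟨hl.1, hl.2.trans_le (not_lt.1 ho)⟩

/-- No queued timeout is below that of the head, and a pending instance has recorded half of its
next timeout. -/
theorem Inv.length_le_tailCount (h : s.Inv κ₀ x) (hκ : 0 < κ₀) {l : ℕ} {θ : ℝ}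
    {Q : List (ℕ × ℝ)} (hQ : s.queue = (l, θ) :: Q) {y : ℝ} (hy : y < θ / 2) :
    s.queue.length ≤ tailCount s.obs s.numActive y := by
  rw [← List.length_map (f := Prod.fst), ← List.toFinset_card_of_nodup h.nodup]
  refine Finset.card_le_card fun l' hl => ?_
  simp only [List.mem_toFinset, List.mem_map] at hl
  obtain ⟨e, he, rfl⟩ := hl
  obtain ⟨h1, h2, -⟩ := h.queue_spec e he
  have h3 : θ ≤ e.2 := by
    rw [hQ, List.mem_cons] at he
    rcases he with rfl | he
    · exact le_rfl
    · exact (h.head_spec hκ hQ).2.1 e he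
  simp only [Finset.mem_filter, Finset.mem_range]
  exact ⟨h1, by linarith⟩

theorem Inv.time_le_sum (h : s.Inv κ₀ x) :
    s.time ≤ 3 * ∑ l ∈ Finset.range s.numActive, s.obs l := by
  refine h.time_le.trans ?_
  rw [Finset.mul_sum]
  exact Finset.sum_le_sum fun l hl =>
    instanceCost_le _ (h.obs_pos l (Finset.mem_range.1 hl)).le

theorem sum_obs_runNew (x : ℕ → ℝ) (s : TesterState) :
    ∑ l ∈ Finset.range (s.runNew x).numActive, (s.runNew x).obs l ≤
      (∑ l ∈ Finset.range s.numActive, s.obs l) + (s.runNew x).θ := by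
  change ∑ l ∈ Finset.range (s.numActive + 1), Function.update s.obs s.numActive _ l ≤ _ + s.θ
  rw [Finset.sum_range_succ, Function.update_self]
  refine add_le_add (Finset.sum_le_sum fun l hl => ?_) (min_le_right _ _)
  rw [Function.update_of_ne (Finset.mem_range.1 hl).ne]

theorem Inv.sum_obs_pop (h : s.Inv κ₀ x) {l : ℕ} {θ : ℝ} {Q : List (ℕ × ℝ)}
    (hQ : s.queue = (l, θ) :: Q) :
    ∑ l' ∈ Finset.range s.numActive, (run x l θ { s with queue := Q }).obs l' ≤
      (∑ l' ∈ Finset.range s.numActive, s.obs l') + θ := by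
  obtain ⟨hl, -, -⟩ := h.queue_spec (l, θ) (hQ ▸ List.mem_cons_self)
  change ∑ l' ∈ Finset.range s.numActive, Function.update s.obs l _ l' ≤ _
  rw [Finset.sum_update_of_mem (Finset.mem_range.2 hl), add_comm, Finset.sdiff_singleton_eq_erase]
  refine add_le_add ?_ (min_le_right _ _)
  exact Finset.sum_le_sum_of_subset_of_nonneg (Finset.erase_subset _ _)
    fun l' hl' _ => (h.obs_pos l' (Finset.mem_range.1 hl')).le

theorem Inv.sum_obs_step (h : s.Inv κ₀ x) (t : ℕ) :
    ∑ l ∈ Finset.range (s.step x t).numActive, (s.step x t).obs l ≤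
      (∑ l ∈ Finset.range s.numActive, s.obs l) + (s.step x t).θ := by
  rcases step_cases x t s with ⟨-, h1⟩ | ⟨l, θ, Q, hQ, -, h1⟩ <;> rw [h1]
  · exact sum_obs_runNew _ _
  · exact h.sum_obs_pop hQ

theorem numActive_step_le (x : ℕ → ℝ) (t : ℕ) (s : TesterState) :
    (s.step x t).numActive ≤ s.numActive + 1 := by
  rcases step_cases x t s with ⟨-, h1⟩ | ⟨l, θ, Q, hQ, -, h1⟩ <;> rw [h1]
  · exact le_rfl
  · exact Nat.le_succ _

end TesterState

/-! ### States along a run -/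

theorem queueSize_mono {r r' t t' : ℕ} (hr : r ≤ r') (ht : 1 ≤ t) (htt : t ≤ t') :
    queueSize r t ≤ queueSize r' t' := by
  unfold queueSize
  have h1 : Real.logb 2 r ≤ max 1 (Real.logb 2 r') := by
    rcases Nat.eq_zero_or_pos r with rfl | h
    · simp
    · exact le_max_of_le_right (Real.logb_le_logb_of_le (by norm_num) (by exact_mod_cast h)
        (by exact_mod_cast hr))
  have h2 : (1 : ℝ) ≤ t := by exact_mod_cast ht
  have h3 : (t : ℝ) ≤ t' := by exact_mod_cast htt
  have h4 : max 1 (Real.logb 2 r) ≤ max 1 (Real.logb 2 r') := max_le (le_max_left _ _) h1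
  have h5 : (0 : ℝ) < max 1 (Real.logb 2 r) := by positivity
  gcongr
  norm_num

section States

variable {N : Type*} {κ₀ : ℝ} {x : N → ℕ → ℝ} {a : ℕ → N}

theorem states_succ (n : ℕ) (k : N) :
    (k = a n ∧ states κ₀ x a (n + 1) k = (states κ₀ x a n k).step (x k) (n + 1)) ∨
      states κ₀ x a (n + 1) k = states κ₀ x a n k := by
  by_cases h : k = a n
  · exact Or.inl ⟨h, by simp only [states]; rw [if_pos h]⟩
  · right; simp only [states]; rw [if_neg h]

theorem states_inv (hκ : 0 < κ₀) (hx : ∀ k l, κ₀ ≤ x k l) (n : ℕ) (k : N) :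
    (states κ₀ x a n k).Inv κ₀ (x k) := by
  induction n with
  | zero => exact TesterState.inv_init _ _
  | succ n ih =>
    rcases states_succ (κ₀ := κ₀) (x := x) (a := a) n k with ⟨-, h⟩ | h <;> rw [h]
    · exact ih.step hκ (hx k) _
    · exact ih

theorem numActive_states_le (n : ℕ) (k : N) : (states κ₀ x a n k).numActive ≤ n := by
  induction n with
  | zero => exact le_rfl
  | succ n ih =>
    rcases states_succ (κ₀ := κ₀) (x := x) (a := a) n k with ⟨-, h⟩ | h <;> rw [h]
    · exact (TesterState.numActive_step_le _ _ _).trans (Nat.succ_le_succ ih)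
    · omega

/-- Popping frees the place that a timed-out run takes again, and an activation requires a free
place. The limit is that of the next iteration, `n + 1`, in which the bounds are compared. -/
theorem length_queue_states_le (n : ℕ) (k : N) :
    (states κ₀ x a n k).queue.length ≤ queueSize (states κ₀ x a n k).numActive (n + 1) := by
  induction n with
  | zero => exact Nat.zero_le _
  | succ n ih =>
    rcases states_succ (κ₀ := κ₀) (x := x) (a := a) n k with ⟨-, h⟩ | h <;> rw [h]
    · rcases TesterState.step_cases (x k) (n + 1) (states κ₀ x a n k) with
        ⟨h1, h2⟩ | ⟨l, θ, Q, hQ, -, h2⟩ <;> rw [h2]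
      · refine (TesterState.length_run_le _ _ _ _).trans (Nat.succ_le_of_lt (h1.trans_le ?_))
        exact queueSize_mono (Nat.le_succ _) (by omega) (by omega)
      · refine (TesterState.length_run_le _ _ _ _).trans ?_
        rw [hQ] at ih
        exact ih.trans (queueSize_mono le_rfl (by omega) (by omega))
    · exact ih.trans (queueSize_mono le_rfl (by omega) (by omega))

end States

/-! ### Size of the queue -/

theorem half_le_log_two : (1 : ℝ) / 2 ≤ Real.log 2 := by have := Real.log_two_gt_d9; linarith

theorem log_two_le_log {t : ℕ} (ht : 2 ≤ t) : Real.log 2 ≤ Real.log t :=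
  Real.log_le_log (by norm_num) (by exact_mod_cast ht)

theorem log_mul_max_logb_le {r t : ℕ} (hr : r ≤ t) (ht : 2 ≤ t) :
    Real.log (t * max 1 (Real.logb 2 r)) ≤ 2 * Real.log t := by
  have ht' : (2 : ℝ) ≤ t := by exact_mod_cast ht
  have h1 : max 1 (Real.logb 2 r) ≤ t :=
    max_le (by linarith) ((logb_two_le_self r).trans (by exact_mod_cast hr))
  rw [two_mul, ← Real.log_mul (by positivity) (by positivity)]
  gcongr

/-- This is where 50 comes from: 50 / ln 2 > 72 = 4 · 18, which is what `le_beta` asks for with η =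
1/2. A tail that contains a full queue is therefore not cut off by `beta`. -/
theorem log_le_queueSize (r : ℕ) {t : ℕ} (ht : 1 ≤ t) :
    72 * Real.log (t * max 1 (Real.logb 2 r)) ≤ queueSize r t := by
  have h0 : 0 ≤ Real.log (t * max 1 (Real.logb 2 r)) :=
    Real.log_nonneg (one_le_mul_of_one_le_of_one_le (by exact_mod_cast ht) (le_max_left _ _))
  have h1 : 50 * Real.logb 2 (t * max 1 (Real.logb 2 r)) ≤ queueSize r t :=
    (Nat.le_ceil _).trans (by exact_mod_cast le_max_right _ _)
  refine le_trans ?_ h1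
  have h2 : 0 < Real.log 2 := Real.log_pos (by norm_num)
  generalize (t : ℝ) * max 1 (Real.logb 2 r) = A at h0
  rw [Real.logb, ← mul_div_assoc, le_div_iff₀ h2]
  have := Real.log_two_lt_d9
  nlinarith

theorem log_le_queueSize' (r : ℕ) {t : ℕ} (ht : 1 ≤ t) : 72 * Real.log t ≤ queueSize r t := by
  refine le_trans ?_ (log_le_queueSize r ht)
  have ht' : (1 : ℝ) ≤ t := by exact_mod_cast ht
  gcongr
  exact le_mul_of_one_le_right (by linarith) (le_max_left _ _)

theorem two_le_queueSize (r : ℕ) {t : ℕ} (ht : 2 ≤ t) : 2 ≤ queueSize r t := by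
  have h := log_le_queueSize' r (by omega : 1 ≤ t)
  have h1 := log_two_le_log ht
  have h2 := half_le_log_two
  have : (2 : ℝ) ≤ queueSize r t := by linarith
  exact_mod_cast this

theorem queueSize_le {r t : ℕ} (hr : r ≤ t) (ht : 2 ≤ t) :
    (queueSize r t : ℝ) ≤ 150 * Real.log t := by
  have h0 : 0 ≤ Real.log (t * max 1 (Real.logb 2 r)) :=
    Real.log_nonneg (one_le_mul_of_one_le_of_one_le (by exact_mod_cast (by omega : 1 ≤ t))
      (le_max_left _ _))
  have hl := Real.log_two_gt_d9
  have h1 := log_two_le_log ht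
  have h2 : 50 * Real.logb 2 (t * max 1 (Real.logb 2 r)) ≤ 146 * Real.log t := by
    rw [Real.logb, ← mul_div_assoc, div_le_iff₀ (by linarith)]
    have := log_mul_max_logb_le hr ht
    nlinarith
  have h3 := Nat.ceil_lt_add_one (mul_nonneg (by norm_num : (0 : ℝ) ≤ 50)
    (div_nonneg h0 (by linarith : 0 ≤ Real.log 2)))
  unfold queueSize
  rw [Nat.cast_max, max_le_iff]
  constructor
  · push_cast; linarith
  · refine h3.le.trans ?_
    change 50 * Real.logb 2 _ + 1 ≤ _
    linarith

theorem two_thirds_le_beta {m r t : ℕ} (ht : 2 ≤ t) (hm : queueSize r t ≤ m) (hmr : m ≤ r) :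
    2 / 3 * ((m : ℝ) / r) ≤ beta (m / r) r t := by
  have h1 := log_le_queueSize r (by omega : 1 ≤ t)
  have h2 : (queueSize r t : ℝ) ≤ m := by exact_mod_cast hm
  have := le_beta (η := 1 / 2) (by omega : 1 ≤ t) ((two_le_queueSize r ht).trans hm) hmr
    (by norm_num) le_rfl (by linarith)
  refine le_trans (le_of_eq ?_) this
  ring

/-! ### What the confidence bound says about timeouts, recorded outcomes and capped means -/

namespace TesterState

variable {κ₀ : ℝ} {x : ℕ → ℝ} {s : TesterState}

/-- The timeout at the head of a full queue is controlled by the lower confidence bound. -/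
theorem Inv.head_mul_queueSize_le (h : s.Inv κ₀ x) (hκ : 0 < κ₀) {l t : ℕ} {θ : ℝ}
    {Q : List (ℕ × ℝ)} (hQ : s.queue = (l, θ) :: Q) (ht : 2 ≤ t)
    (hq : queueSize s.numActive t ≤ s.queue.length) :
    θ * queueSize s.numActive t ≤ 3 * (s.numActive * s.lcb t) := by
  have hl := (h.queue_spec (l, θ) (hQ ▸ List.mem_cons_self)).1
  have hr : (0 : ℝ) < s.numActive := by exact_mod_cast (Nat.zero_le _).trans_lt hl
  have hθ : 0 < θ := hκ.trans_le (h.le_θ.trans (h.head_spec hκ hQ).1)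
  rw [lcb_eq]
  -- Below θ / 2 the empirical tail contains the whole queue, so the integrand is at least (2/3) q /
  -- r; the integral over (0, θ / 2) gives θ q / (3 r).
  have h1 := setIntegral_le_sampleLcb s.obs s.numActive (by omega : 1 ≤ t) (θ / 2)
    (g := fun _ => 2 / 3 * (queueSize s.numActive t / s.numActive : ℝ))
    (integrableOn_const (by simp))
    (fun y hy => by
      have h2 := hq.trans (h.length_le_tailCount hκ hQ hy.2)
      refine le_trans ?_ (two_thirds_le_beta ht h2 (SPC.tailCount_le _ _ _))
      gcongr)
  rw [setIntegral_const, measureReal_def, Real.volume_Ioo, ENNReal.toReal_ofReal (by linarith),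
    smul_eq_mul] at h1
  calc θ * queueSize s.numActive t
      = 3 * (s.numActive * ((θ / 2 - 0) *
          (2 / 3 * (queueSize s.numActive t / s.numActive : ℝ)))) := by field_simp; ring
    _ ≤ _ := by gcongr

/-- Pointwise, count - q ≤ (3/2) r β(count / r): a count below q makes the left side nonpositive,
and a larger one is reliable. No outcome exceeds θ, so integrating the counts over (0, θ) gives the
full sum. -/
theorem Inv.sum_obs_le (h : s.Inv κ₀ x) (hκ : 0 < κ₀) {t : ℕ} (ht : 2 ≤ t) :
    ∑ l ∈ Finset.range s.numActive, s.obs l ≤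
      3 / 2 * (s.numActive * s.lcb t) + s.θ * queueSize s.numActive t := by
  have hθ : 0 < s.θ := hκ.trans_le h.le_θ
  rcases Nat.eq_zero_or_pos s.numActive with hr | hr
  · simp only [hr, Finset.range_zero, Finset.sum_empty, Nat.cast_zero, zero_mul, mul_zero, zero_add]
    positivity
  have hr' : (0 : ℝ) < s.numActive := by exact_mod_cast hr
  have hN := integrableOn_tailCount s.obs s.numActive s.θ
  have hc : IntegrableOn (fun _ => (queueSize s.numActive t : ℝ)) (Set.Ioo 0 s.θ) := by simp
  have h1 := setIntegral_le_sampleLcb s.obs s.numActive (by omega : 1 ≤ t) s.θ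
    (g := fun y => 2 / 3 / (s.numActive : ℝ) *
      ((tailCount s.obs s.numActive y : ℝ) - queueSize s.numActive t))
    ((hN.sub hc).const_mul _) (fun y hy => by
      rcases le_total (queueSize s.numActive t) (tailCount s.obs s.numActive y) with hle | hle
      · refine le_trans ?_ (two_thirds_le_beta ht hle (SPC.tailCount_le _ _ _))
        rw [div_mul_eq_mul_div, mul_div_assoc]
        gcongr
        simp
      · refine le_trans ?_ (beta_nonneg (by positivity) _ _)
        refine mul_nonpos_of_nonneg_of_nonpos (by positivity) (sub_nonpos.2 ?_)
        exact_mod_cast hle)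
  rw [integral_const_mul, integral_sub hN hc,
    setIntegral_tailCount (fun l hl => (h.obs_pos l hl).le) hθ.le, setIntegral_const,
    measureReal_def, Real.volume_Ioo, ENNReal.toReal_ofReal (by linarith), smul_eq_mul,
    Finset.sum_congr rfl fun l hl => min_eq_left (h.obs_le_θ l (Finset.mem_range.1 hl)),
    ← lcb_eq, sub_zero] at h1
  have h2 : (∑ l ∈ Finset.range s.numActive, s.obs l) - s.θ * queueSize s.numActive t =
      3 / 2 * (s.numActive * (2 / 3 / (s.numActive : ℝ) *
        ((∑ l ∈ Finset.range s.numActive, s.obs l) - s.θ * queueSize s.numActive t))) := by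
    field_simp
  have h3 : 3 / 2 * (s.numActive * (2 / 3 / (s.numActive : ℝ) *
        ((∑ l ∈ Finset.range s.numActive, s.obs l) - s.θ * queueSize s.numActive t))) ≤
      3 / 2 * (s.numActive * s.lcb t) := by gcongr
  linarith

/-- With enough active instances that represent the distribution well, the lower confidence bound
is nearly the capped mean. -/
theorem Inv.le_lcb (h : s.Inv κ₀ x) (hκ : 0 < κ₀) (hx : ∀ l, κ₀ ≤ x l) {t : ℕ} (ht : 2 ≤ t)
    (hrt : s.numActive ≤ t)
    (hQ : s.queue.length ≤ queueSize s.numActive t) {y δ ε M : ℝ} (hy : 0 < y)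
    (hε : 0 < ε) (hε1 : ε ≤ 1) (hA : 2592 * Real.log t ≤ s.numActive * δ * ε ^ 2)
    (hcount : (1 - ε / 6) * (s.numActive * δ) ≤
      (((Finset.range s.numActive).filter fun l => y ≤ x l).card : ℝ))
    (hsum : (1 - ε / 6) * (s.numActive * M) ≤ ∑ l ∈ Finset.range s.numActive, min (x l) y) :
    (1 - ε / 6) ^ 2 / (1 + ε / 6) * M ≤ s.lcb t := by
  have hlog : 0 < Real.log t := by
    have := half_le_log_two; have := log_two_le_log ht; linarith
  have hr : 0 < s.numActive := by
    rcases Nat.eq_zero_or_pos s.numActive with h0 | h0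
    · rw [h0] at hA; simp only [Nat.cast_zero, zero_mul] at hA; linarith
    · exact h0
  have hr' : (0 : ℝ) < s.numActive := by exact_mod_cast hr
  have hA1 : 2592 * Real.log t ≤ s.numActive * δ * ε := by
    refine hA.trans ?_
    have h0 : 0 ≤ s.numActive * δ := by
      by_contra! hneg
      nlinarith [sq_nonneg ε]
    exact mul_le_mul_of_nonneg_left (by nlinarith) h0
  have hrδ : 0 < s.numActive * δ := by
    by_contra! hneg
    nlinarith
  -- The queue has at most 150 ln t entries, and 150 ≤ 2592 / 12.
  have hQ' : (s.queue.length : ℝ) ≤ ε / 12 * (s.numActive * δ) := by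
    have h1 : (s.queue.length : ℝ) ≤ queueSize s.numActive t := by exact_mod_cast hQ
    have h2 := queueSize_le hrt ht
    nlinarith
  rw [lcb_eq]
  have h1 := setIntegral_le_sampleLcb s.obs s.numActive (by omega : 1 ≤ t) y
    (g := fun z => (1 - ε / 6) / (1 + ε / 6) / s.numActive * (tailCount x s.numActive z : ℝ))
    ((integrableOn_tailCount _ _ _).const_mul _) (fun z hz => by
      have hNx : (1 - ε / 6) * (s.numActive * δ) ≤ tailCount x s.numActive z := by
        refine hcount.trans ?_
        exact_mod_cast Finset.card_le_card
          (Finset.monotone_filter_right _ fun l _ hl => hz.2.trans_le hl)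
      have hN : (tailCount x s.numActive z : ℝ) ≤
          tailCount s.obs s.numActive z + s.queue.length := by exact_mod_cast h.tailCount_le z
      -- The true count is at least (5/6) r δ, so the pending instances are less than a fraction ε /
      -- 6 of it.
      have hN2 : (1 - ε / 6) * (tailCount x s.numActive z : ℝ) ≤
          tailCount s.obs s.numActive z := by nlinarith
      have hN3 : (25 / 36 : ℝ) * (s.numActive * δ) ≤ tailCount s.obs s.numActive z := by nlinarith
      -- From 2592 · 25 / 36² = 50 ≥ 36; and 36 ln t = 18 · 2 ln t is what `le_beta` needs with η =
      -- ε / 6.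
      have hN4 : 36 * Real.log t ≤ (ε / 6) ^ 2 * tailCount s.obs s.numActive z := by
        have : (ε / 6) ^ 2 * ((25 / 36 : ℝ) * (s.numActive * δ)) ≤
          (ε / 6) ^ 2 * tailCount s.obs s.numActive z := by gcongr
        nlinarith
      have hN5 : (2 : ℝ) ≤ tailCount s.obs s.numActive z := by
        have h2 := half_le_log_two
        have h3 := log_two_le_log ht
        have h4 : (ε / 6) ^ 2 ≤ 1 := by nlinarith
        have h5 : (0 : ℝ) ≤ tailCount s.obs s.numActive z := by positivity
        nlinarith
      have h6 := log_mul_max_logb_le hrt ht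
      have h7 := le_beta (η := ε / 6) (by omega : 1 ≤ t) (by exact_mod_cast hN5)
        (SPC.tailCount_le s.obs s.numActive z) (by positivity) (by linarith) (by linarith)
      refine le_trans ?_ h7
      calc _ = (1 - ε / 6) * (tailCount x s.numActive z : ℝ) / s.numActive / (1 + ε / 6) := by
            field_simp
        _ ≤ _ := by gcongr)
  rw [integral_const_mul, setIntegral_tailCount (fun l _ => hκ.le.trans (hx l)) hy.le] at h1
  refine le_trans ?_ h1
  have h0 : 0 < 1 - ε / 6 := by linarith
  calc (1 - ε / 6) ^ 2 / (1 + ε / 6) * M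
      = (1 - ε / 6) / (1 + ε / 6) / s.numActive * ((1 - ε / 6) * (s.numActive * M)) := by
        field_simp
    _ ≤ _ := by gcongr

end TesterState

theorem log_natCast_mono {m n : ℕ} (h : m ≤ n) : Real.log m ≤ Real.log n := by
  rcases Nat.eq_zero_or_pos m with rfl | h0
  · simpa using Real.log_natCast_nonneg n
  · exact Real.log_le_log (by exact_mod_cast h0) (by exact_mod_cast h)

/-! ### Deterministic bounds along a trajectory -/

section Trajectory

variable {N : Type*} {κ₀ : ℝ} {x : N → ℕ → ℝ} {a : ℕ → N}

/-- If every activation beyond `ρ ln s` instances in iteration `s` is charged to `s` or to the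
number of active instances, then the number of active instances is bounded. -/
theorem numActive_states_le_of_charge {i : N} {ρ : ℝ} (hρ : 0 ≤ ρ) {b b' : ℕ → ℝ}
    (hb : ∀ s, 0 ≤ b s) (hb' : ∀ r, 0 ≤ b' r) {t : ℕ}
    (h : ∀ n, 1 ≤ n → n + 1 ≤ t → i = a n → 1 ≤ (states κ₀ x a n i).numActive →
      ρ * Real.log (n + 1 : ℕ) ≤ (states κ₀ x a n i).numActive →
      1 ≤ b (n + 1) ∨ 1 ≤ b' (states κ₀ x a n i).numActive) :
    ∀ n ≤ t, ((states κ₀ x a n i).numActive : ℝ) ≤ ρ * Real.log n + 1 +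
      ∑ s ∈ Finset.range (n + 1), b s +
        ∑ r ∈ Finset.range (states κ₀ x a n i).numActive, b' r := by
  intro n
  induction n with
  | zero =>
    intro _
    have h1 := Finset.sum_nonneg fun s (_ : s ∈ Finset.range (0 + 1)) => hb s
    have h2 : (states κ₀ x a 0 i).numActive = 0 := rfl
    simp only [h2, Nat.cast_zero, Real.log_zero, mul_zero, Finset.range_zero, Finset.sum_empty]
    linarith
  | succ n ih =>
    intro hn
    have ih := ih (by omega)
    have hlog : Real.log n ≤ Real.log (n + 1 : ℕ) := log_natCast_mono (Nat.le_succ n)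
    have hρlog := mul_le_mul_of_nonneg_left hlog hρ
    have h0 : 0 ≤ ρ * Real.log (n + 1 : ℕ) := mul_nonneg hρ (Real.log_natCast_nonneg _)
    have hs := Finset.sum_nonneg fun s (_ : s ∈ Finset.range (n + 1)) => hb s
    have hs' := Finset.sum_nonneg fun s
      (_ : s ∈ Finset.range (states κ₀ x a n i).numActive) => hb' s
    have hbn := hb (n + 1)
    have hbn' := hb' (states κ₀ x a n i).numActive
    have same : ((states κ₀ x a n i).numActive : ℝ) ≤ ρ * Real.log (n + 1 : ℕ) + 1 +
      ∑ s ∈ Finset.range (n + 1 + 1), b s +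
        ∑ r ∈ Finset.range (states κ₀ x a n i).numActive, b' r := by
      rw [Finset.sum_range_succ _ (n + 1)]; linarith
    rcases states_succ (κ₀ := κ₀) (x := x) (a := a) n i with ⟨hi, hst⟩ | hst
    · rw [hst]
      rcases TesterState.step_cases (x i) (n + 1) (states κ₀ x a n i) with
        ⟨-, h1⟩ | ⟨l, θ, Q, -, -, h1⟩
      · rw [h1]
        change (((states κ₀ x a n i).numActive + 1 : ℕ) : ℝ) ≤ _ + 1 + _ +
          ∑ r ∈ Finset.range ((states κ₀ x a n i).numActive + 1), b' r
        rw [Finset.sum_range_succ _ (states κ₀ x a n i).numActive,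
          Finset.sum_range_succ _ (n + 1)]
        push_cast at *
        -- The summand 1 pays for the first activation, and for one made below the threshold. Any
        -- other is charged to iteration `n + 1` or to the current number of active instances;
        -- neither recurs at a later activation.
        rcases Nat.eq_zero_or_pos (states κ₀ x a n i).numActive with hr | hr
        · have : ((states κ₀ x a n i).numActive : ℝ) = 0 := by exact_mod_cast hr
          linarith
        by_cases hlarge : ρ * Real.log (n + 1) ≤ (states κ₀ x a n i).numActive
        · have hn1 : 1 ≤ n := hr.trans_le (numActive_states_le n i)
          rcases h n hn1 hn hi hr hlarge with h2 | h2 <;> linarith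
        · linarith
      · rw [h1]
        exact same
    · rw [hst]
      exact same

/-- Bounds on the number of active instances and on the lower confidence bounds at the times of
selection give a bound on the total time. -/
theorem time_states_le (hκ : 0 < κ₀) (hx : ∀ k l, κ₀ ≤ x k l) {i : N} {t : ℕ} (ht : 2 ≤ t)
    {ρ c K W m : ℝ} (hρ : 1 ≤ ρ) (hc : 1 ≤ c) (hK : 0 ≤ K) (hW : 0 ≤ W) (hm : κ₀ ≤ m)
    (hr : ∀ n ≤ t, ((states κ₀ x a n i).numActive : ℝ) ≤ ρ * Real.log n + 1 + K)
    (hL : ∀ n, 1 ≤ n → n + 1 ≤ t → i = a n →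
      (states κ₀ x a n i).numActive * (states κ₀ x a n i).lcb (n + 1) ≤
        m * (c * (states κ₀ x a n i).numActive + W)) :
    (states κ₀ x a t i).time ≤ 2295 * c * m * Real.log t * (ρ + K + W) := by
  have hm0 : 0 < m := hκ.trans_le hm
  -- A bound for all timeouts. It contains ρ without a logarithm, because the estimate for the head
  -- divides by the queue size, which dominates the logarithm. The summand 1 covers the initial
  -- timeout κ₀ ≤ m.
  set Θ := m * (1 + c * ρ + 3 * (c * (1 + K) + W)) with hΘ
  have hmΘ : m ≤ Θ := by
    rw [hΘ]; refine le_mul_of_one_le_right hm0.le ?_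
    have : 0 ≤ c * ρ + 3 * (c * (1 + K) + W) := by positivity
    linarith
  have hΘ0 : 0 ≤ Θ := hm0.le.trans hmΘ
  have hinv := fun n => states_inv (a := a) hκ hx n i
  have hr' : ∀ n, n + 1 ≤ t →
      ((states κ₀ x a n i).numActive : ℝ) ≤ ρ * Real.log (n + 1 : ℕ) + 1 + K := by
    intro n hn
    have := mul_le_mul_of_nonneg_left (log_natCast_mono (Nat.le_succ n)) (zero_le_one.trans hρ)
    exact (hr n (by omega)).trans (by linarith)
  have hθ : ∀ n ≤ t, (states κ₀ x a n i).θ ≤ Θ := by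
    intro n
    induction n with
    | zero => exact fun _ => hm.trans hmΘ
    | succ n ih =>
      intro hn
      have ih := ih (by omega)
      rcases states_succ (κ₀ := κ₀) (x := x) (a := a) n i with ⟨hi, hst⟩ | hst <;> rw [hst]
      · rcases TesterState.step_cases (x i) (n + 1) (states κ₀ x a n i) with
          ⟨-, h1⟩ | ⟨l, θ, Q, hQ, hq, h1⟩ <;> rw [h1]
        · exact ih
        · change θ ≤ Θ
          have hn1 : 1 ≤ n := by
            rcases Nat.eq_zero_or_pos n with rfl | h0
            · simp [states, TesterState.init] at hQ
            · exact h0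
          have h2 := (hinv n).head_mul_queueSize_le hκ hQ (by omega : 2 ≤ n + 1) hq
          have h3 := hL n hn1 hn hi
          have h4 := hr' n hn
          have h5 := log_le_queueSize' (states κ₀ x a n i).numActive (by omega : 1 ≤ n + 1)
          have h6 : (1 : ℝ) ≤ queueSize (states κ₀ x a n i).numActive (n + 1) := by
            exact_mod_cast TesterState.queueSize_pos _ _
          set q := ((queueSize (states κ₀ x a n i).numActive (n + 1) : ℕ) : ℝ)
          refine le_of_mul_le_mul_right ?_ (by linarith : 0 < q)
          calc θ * q ≤ 3 * (m * (c * (states κ₀ x a n i).numActive + W)) := by linarith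
            _ ≤ 3 * (m * (c * (ρ * Real.log (n + 1 : ℕ) + 1 + K) + W)) := by gcongr
            _ ≤ 3 * (m * (c * (ρ * (q / 3) + 1 + K) + W)) := by
                have := Real.log_natCast_nonneg (n + 1)
                gcongr; linarith
            _ = m * (c * ρ * q + 3 * (c * (1 + K) + W) * 1) := by ring
            _ ≤ m * (c * ρ * q + 3 * (c * (1 + K) + W) * q) := by gcongr
            _ ≤ Θ * q := by
                rw [hΘ]
                have : 0 ≤ m * q := by positivity
                linarith
      · exact ih
  -- `S` bounds the sum of outcomes just before a selection of `i`, the only times at which its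
  -- confidence bound is controlled. The run then adds at most Θ, and iterations spent elsewhere
  -- change nothing.
  set S := 3 / 2 * (m * (c * (ρ * Real.log t + 1 + K) + W)) + Θ * (150 * Real.log t) with hS
  have hlt := log_two_le_log ht
  have hl2 := half_le_log_two
  have hS0 : 0 ≤ S := by
    have : 0 ≤ Real.log t := by linarith
    positivity
  have hsum : ∀ n ≤ t, ∑ l ∈ Finset.range (states κ₀ x a n i).numActive,
      (states κ₀ x a n i).obs l ≤ S + Θ := by
    intro n
    induction n with
    | zero =>
        intro _
        change ∑ l ∈ Finset.range 0, _ ≤ _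
        rw [Finset.sum_range_zero]; linarith
    | succ n ih =>
      intro hn
      have hθn := hθ n (by omega)
      have hθn1 := hθ (n + 1) hn
      rcases states_succ (κ₀ := κ₀) (x := x) (a := a) n i with ⟨hi, hst⟩ | hst
      · rw [hst] at hθn1 ⊢
        refine ((hinv n).sum_obs_step (n + 1)).trans (add_le_add ?_ hθn1)
        rcases Nat.eq_zero_or_pos n with rfl | hn1
        · change ∑ l ∈ Finset.range 0, _ ≤ _
          rw [Finset.sum_range_zero]; exact hS0
        · refine ((hinv n).sum_obs_le hκ (by omega : 2 ≤ n + 1)).trans ?_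
          have h3 := hL n hn1 hn hi
          have h4 := hr' n hn
          have h5 := queueSize_le ((numActive_states_le (κ₀ := κ₀) (x := x) (a := a) n i).trans
            (Nat.le_succ n)) (by omega : 2 ≤ n + 1)
          have h6 : Real.log (n + 1 : ℕ) ≤ Real.log t := log_natCast_mono hn
          rw [hS]
          refine add_le_add ?_ ?_
          · refine mul_le_mul_of_nonneg_left (h3.trans ?_) (by norm_num)
            gcongr
            refine h4.trans ?_
            gcongr
          · exact mul_le_mul hθn (h5.trans (by gcongr)) (by positivity) hΘ0
      · rw [hst]; exact ih (by omega)
  refine (hinv t).time_le_sum.trans ((mul_le_mul_of_nonneg_left (hsum t le_rfl)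
    (by norm_num)).trans ?_)
  set L := Real.log t
  have hL1 : 1 / 2 ≤ L := hl2.trans hlt
  have e1 : c * (ρ * L + 1 + K) + W ≤ L * (c * (3 * ρ + 2 * K + 2 * W)) := by
    have h1 : 1 ≤ 2 * L := by linarith
    have h2 : c * 1 ≤ c * (2 * L * ρ) :=
      mul_le_mul_of_nonneg_left (by nlinarith) (by linarith)
    have h3 : c * K * 1 ≤ c * K * (2 * L) := by gcongr
    have h4 : W ≤ c * W * (2 * L) := by
      have : 0 ≤ c * W := by positivity
      nlinarith
    nlinarith
  have e2 : 1 + c * ρ + 3 * (c * (1 + K) + W) ≤ c * (5 * ρ + 3 * K + 3 * W) := by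
    nlinarith
  have e3 : 150 * L + 1 ≤ 152 * L := by linarith
  calc 3 * (S + Θ) = m * (9 / 2 * (c * (ρ * L + 1 + K) + W) +
        3 * ((1 + c * ρ + 3 * (c * (1 + K) + W)) * (150 * L + 1))) := by rw [hS, hΘ]; ring
    _ ≤ m * (9 / 2 * (L * (c * (3 * ρ + 2 * K + 2 * W))) +
        3 * ((c * (5 * ρ + 3 * K + 3 * W)) * (152 * L))) := by gcongr
    _ = c * m * L * (2293.5 * ρ + 1377 * K + 1377 * W) := by ring
    _ ≤ c * m * L * (2295 * (ρ + K + W)) := by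
        gcongr; linarith
    _ = _ := by ring

end Trajectory

/-! ### Chernoff bounds for independent variables in [0, 1] -/

section Chernoff

variable {Ω : Type*} [MeasurableSpace Ω] {P : Measure Ω} [IsProbabilityMeasure P]

theorem exp_mul_le_of_mem_Icc (t : ℝ) {z : ℝ} (h0 : 0 ≤ z) (h1 : z ≤ 1) :
    Real.exp (t * z) ≤ 1 + z * (Real.exp t - 1) := by
  have := convexOn_exp.2 (Set.mem_univ 0) (Set.mem_univ t) (sub_nonneg.2 h1) h0 (by ring)
  simp only [smul_eq_mul, mul_zero, zero_add, Real.exp_zero, mul_one] at this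
  rw [mul_comm t z]
  linarith

theorem exp_neg_le_quadratic {η : ℝ} (h : 0 ≤ η) : Real.exp (-η) ≤ 1 - η + η ^ 2 / 2 := by
  have h1 := Real.quadratic_le_exp_of_nonneg h
  have h2 : Real.exp (-η) * Real.exp η = 1 := by rw [← Real.exp_add]; simp
  have h3 : 0 < Real.exp (-η) := Real.exp_pos _
  have h4 : 0 < 1 + η + η ^ 2 / 2 := by positivity
  refine le_of_mul_le_mul_right ?_ h4
  have : Real.exp (-η) * (1 + η + η ^ 2 / 2) ≤ 1 :=
    (mul_le_mul_of_nonneg_left h1 h3.le).trans h2.le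
  nlinarith [sq_nonneg (η ^ 2)]

variable {Z : ℕ → Ω → ℝ}

/-- Convexity of exp. With the factor e^t - 1 in `hq`, one statement serves upper bounds on the mean
for t ≥ 0 and lower bounds for t ≤ 0. -/
theorem mgf_le_exp {Y : Ω → ℝ} (hY : Measurable Y) (h0 : ∀ ω, 0 ≤ Y ω)
    (h1 : ∀ ω, Y ω ≤ 1) {t q : ℝ} (hq : P[Y] * (Real.exp t - 1) ≤ q * (Real.exp t - 1)) :
    mgf Y P t ≤ Real.exp (q * (Real.exp t - 1)) := by
  have hb : ∀ {f : Ω → ℝ}, Measurable f → ∀ C, (∀ ω, 0 ≤ f ω) → (∀ ω, f ω ≤ C) → Integrable f P :=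
    fun hf C h h' => Integrable.of_bound hf.aestronglyMeasurable C
      (Filter.Eventually.of_forall fun ω => by rw [Real.norm_of_nonneg (h ω)]; exact h' ω)
  have hi : Integrable Y P := hb hY 1 h0 h1
  have hi2 : Integrable (fun ω => 1 + Y ω * (Real.exp t - 1)) P :=
    (integrable_const 1).add (hi.mul_const _)
  have hle := fun ω => exp_mul_le_of_mem_Icc t (h0 ω) (h1 ω)
  calc mgf Y P t ≤ ∫ ω, (1 + Y ω * (Real.exp t - 1)) ∂P := by
        refine integral_mono_of_nonneg (Filter.Eventually.of_forall fun ω => (Real.exp_pos _).le)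
          hi2 (Filter.Eventually.of_forall hle)
    _ = 1 + P[Y] * (Real.exp t - 1) := by
        rw [integral_add (integrable_const 1) (hi.mul_const _), integral_mul_const]; simp
    _ ≤ q * (Real.exp t - 1) + 1 := by linarith
    _ ≤ _ := Real.add_one_le_exp _

theorem mgf_sum_le (hZ : ∀ l, Measurable (Z l)) (hind : iIndepFun Z P) (h0 : ∀ l ω, 0 ≤ Z l ω)
    (h1 : ∀ l ω, Z l ω ≤ 1) {t q : ℝ}
    (hq : ∀ l, P[Z l] * (Real.exp t - 1) ≤ q * (Real.exp t - 1)) (r : ℕ) :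
    mgf (∑ l ∈ Finset.range r, Z l) P t ≤ Real.exp (r * q * (Real.exp t - 1)) := by
  rw [hind.mgf_sum hZ]
  calc _ ≤ ∏ l ∈ Finset.range r, Real.exp (q * (Real.exp t - 1)) :=
        Finset.prod_le_prod (fun _ _ => mgf_nonneg)
          fun l _ => mgf_le_exp (hZ l) (h0 l) (h1 l) (hq l)
    _ = _ := by rw [Finset.prod_const, Finset.card_range, ← Real.exp_nat_mul, mul_assoc]

theorem integrable_exp_mul_sum (hZ : ∀ l, Measurable (Z l)) (h0 : ∀ l ω, 0 ≤ Z l ω)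
    (h1 : ∀ l ω, Z l ω ≤ 1) (t : ℝ) (r : ℕ) :
    Integrable (fun ω => Real.exp (t * (∑ l ∈ Finset.range r, Z l) ω)) P := by
  have hm : Measurable (∑ l ∈ Finset.range r, Z l) := by
    rw [Finset.sum_fn]; exact Finset.measurable_sum _ fun l _ => hZ l
  refine Integrable.of_bound (by fun_prop) (Real.exp (|t| * r))
    (Filter.Eventually.of_forall fun ω => ?_)
  rw [Real.norm_of_nonneg (Real.exp_pos _).le, Real.exp_le_exp, Finset.sum_apply]
  have hs0 : 0 ≤ ∑ l ∈ Finset.range r, Z l ω := Finset.sum_nonneg fun l _ => h0 l ω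
  have hs : ∑ l ∈ Finset.range r, Z l ω ≤ r := by
    refine (Finset.sum_le_sum fun l _ => h1 l ω).trans ?_
    simp
  calc _ ≤ |t| * ∑ l ∈ Finset.range r, Z l ω := by gcongr; exact le_abs_self t
    _ ≤ _ := by gcongr

/-- Exponential Markov inequality at ln c, the optimal parameter for a threshold c times the bound m
/ c on the mean of the sum. -/
theorem measure_le_sum_le (hZ : ∀ l, Measurable (Z l)) (hind : iIndepFun Z P)
    (h0 : ∀ l ω, 0 ≤ Z l ω) (h1 : ∀ l ω, Z l ω ≤ 1) {m c : ℝ} {r : ℕ} (hc : 1 ≤ c)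
    (hr : 0 < r) (hq : ∀ l, P[Z l] ≤ m / (r * c)) :
    P {ω | m ≤ ∑ l ∈ Finset.range r, Z l ω} ≤
      ENNReal.ofReal (Real.exp (-(m * (Real.log c - 1 + 1 / c)))) := by
  have hc0 : 0 < c := by linarith
  have hr' : (0 : ℝ) < r := by exact_mod_cast hr
  have h2 := measure_ge_le_exp_mul_mgf (X := ∑ l ∈ Finset.range r, Z l) m (Real.log_nonneg hc)
    (integrable_exp_mul_sum (P := P) hZ h0 h1 _ _)
  have h3 := mgf_sum_le (t := Real.log c) (q := m / (r * c)) hZ hind h0 h1 (fun l =>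
    mul_le_mul_of_nonneg_right (hq l) (by rw [Real.exp_log hc0]; linarith)) r
  have h4 : P.real {ω | m ≤ ∑ l ∈ Finset.range r, Z l ω} ≤
      Real.exp (-(m * (Real.log c - 1 + 1 / c))) := by
    simp only [Finset.sum_apply] at h2
    refine h2.trans ((mul_le_mul_of_nonneg_left h3 (Real.exp_pos _).le).trans (le_of_eq ?_))
    rw [← Real.exp_add, Real.exp_log hc0]
    congr 1
    field_simp
    ring
  rw [← ofReal_measureReal]
  exact ENNReal.ofReal_le_ofReal h4

/-- The parameter -η is not optimal, but together with `exp_neg_le_quadratic` it already gives the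
exponent r q η² / 2. -/
theorem measure_sum_lt_le (hZ : ∀ l, Measurable (Z l)) (hind : iIndepFun Z P)
    (h0 : ∀ l ω, 0 ≤ Z l ω) (h1 : ∀ l ω, Z l ω ≤ 1) {q η : ℝ} {r : ℕ} (hη : 0 ≤ η)
    (hq0 : 0 ≤ q) (hq : ∀ l, q ≤ P[Z l]) :
    P {ω | ∑ l ∈ Finset.range r, Z l ω < (1 - η) * (r * q)} ≤
      ENNReal.ofReal (Real.exp (-(r * q * η ^ 2 / 2))) := by
  have h2 := measure_le_le_exp_mul_mgf (X := ∑ l ∈ Finset.range r, Z l) ((1 - η) * (r * q))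
    (neg_nonpos.2 hη) (integrable_exp_mul_sum (P := P) hZ h0 h1 _ _)
  have hexp : Real.exp (-η) - 1 ≤ 0 := by
    have : Real.exp (-η) ≤ 1 := Real.exp_le_one_iff.2 (neg_nonpos.2 hη)
    linarith
  have h3 := mgf_sum_le (t := -η) (q := q) hZ hind h0 h1 (fun l =>
    mul_le_mul_of_nonpos_right (hq l) hexp) r
  have h4 : P.real {ω | ∑ l ∈ Finset.range r, Z l ω < (1 - η) * (r * q)} ≤
      Real.exp (-(r * q * η ^ 2 / 2)) := by
    simp only [Finset.sum_apply] at h2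
    have hsub : {ω | ∑ l ∈ Finset.range r, Z l ω < (1 - η) * (r * q)} ⊆
      {ω | ∑ l ∈ Finset.range r, Z l ω ≤ (1 - η) * (r * q)} := fun ω hω => by
      simp only [Set.mem_ofPred_eq] at hω ⊢; exact hω.le
    refine (measureReal_mono hsub).trans
      (h2.trans ((mul_le_mul_of_nonneg_left h3 (Real.exp_pos _).le).trans ?_))
    rw [← Real.exp_add, Real.exp_le_exp]
    have h5 := exp_neg_le_quadratic hη
    have h6 : r * q * (Real.exp (-η) - 1) ≤ r * q * (-η + η ^ 2 / 2) := by gcongr; linarith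
    nlinarith
  rw [← ofReal_measureReal]
  exact ENNReal.ofReal_le_ofReal h4

end Chernoff

/-! ### Uniform control of empirical tails -/

section Overshoot

/-- The open half-line of all values with a smaller value of tail probability at most `q`. -/
def tailSet (μ : Measure ℝ) (q : ℝ) : Set ℝ :=
  ⋃ x : {x : ℚ // μ.real (Set.Ioi (x : ℝ)) ≤ q}, Set.Ioi ((x : ℚ) : ℝ)

theorem measurableSet_tailSet (μ : Measure ℝ) (q : ℝ) : MeasurableSet (tailSet μ q) :=
  (isOpen_iUnion fun _ => isOpen_Ioi).measurableSet

/-- The half-lines are nested and, having rational endpoints, countably many, so the measure is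
continuous along their union. -/
theorem measure_tailSet_le (μ : Measure ℝ) [IsFiniteMeasure μ] (q : ℝ) :
    μ (tailSet μ q) ≤ ENNReal.ofReal q := by
  rw [tailSet, Directed.measure_iUnion]
  · refine iSup_le fun x => ?_
    rw [← ofReal_measureReal]
    exact ENNReal.ofReal_le_ofReal x.2
  · intro x y
    rcases le_total x.1 y.1 with h | h
    · exact ⟨x, subset_rfl, Set.Ioi_subset_Ioi (by exact_mod_cast h)⟩
    · exact ⟨y, Set.Ioi_subset_Ioi (by exact_mod_cast h), subset_rfl⟩

theorem Ioi_subset_tailSet {μ : Measure ℝ} [IsFiniteMeasure μ] {q x : ℝ}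
    (h : μ.real (Set.Ioi x) ≤ q) : Set.Ioi x ⊆ tailSet μ q := fun z hz => by
  obtain ⟨y, hy1, hy2⟩ := exists_rat_btwn (Set.mem_Ioi.1 hz)
  exact Set.mem_iUnion.2 ⟨⟨y, (measureReal_mono (Set.Ioi_subset_Ioi hy1.le)).trans h⟩, hy2⟩

/-- At least `m` of `r` values lie in a set of measure at most `m / (r c)`. -/
def Overshoot (μ : Measure ℝ) (y : ℕ → ℝ) (r m : ℕ) (c : ℝ) : Prop :=
  (m : ℝ) ≤ ∑ l ∈ Finset.range r, (tailSet μ (m / (r * c))).indicator (fun _ => (1 : ℝ)) (y l)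

/-- One event per count replaces a supremum over all x: if the empirical tail at x were too large,
the half-line above x would lie in the tail set of that very count. Atoms of the law do no harm. -/
theorem tailCount_div_le_of_not_overshoot {μ : Measure ℝ} [IsFiniteMeasure μ] {y : ℕ → ℝ} {r : ℕ}
    {x c : ℝ} (hc : 0 < c) (h : ¬ Overshoot μ y r (tailCount y r x) c) :
    (tailCount y r x : ℝ) / r ≤ c * μ.real (Set.Ioi x) := by
  by_contra! hlt
  refine h ?_
  have h1 : Set.Ioi x ⊆ tailSet μ (tailCount y r x / (r * c)) := by
    refine Ioi_subset_tailSet ?_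
    rw [← div_div, le_div_iff₀ hc, mul_comm]
    exact hlt.le
  rw [Overshoot, tailCount, Finset.card_filter, Nat.cast_sum]
  refine Finset.sum_le_sum fun l _ => ?_
  by_cases h2 : x < y l
  · rw [if_pos h2]
    have := h1 h2
    rw [tailCount, Finset.card_filter, Nat.cast_sum] at this
    rw [Set.indicator_of_mem this]; simp
  · rw [if_neg h2]
    simp [Set.indicator_nonneg]

variable {Ω : Type*} [MeasurableSpace Ω] {P : Measure Ω} [IsProbabilityMeasure P]
  {μ : Measure ℝ} {Y : ℕ → Ω → ℝ}

theorem measurableSet_overshoot (hY : ∀ l, Measurable (Y l)) (r m : ℕ) (c : ℝ) :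
    MeasurableSet {ω | Overshoot μ (fun l => Y l ω) r m c} := by
  refine measurableSet_le measurable_const (Finset.measurable_sum _ fun l _ => ?_)
  exact (measurable_const.indicator (measurableSet_tailSet _ _)).comp (hY l)

theorem measure_overshoot_le (hY : ∀ l, Measurable (Y l)) (hind : iIndepFun Y P)
    (hμ : ∀ l, P.map (Y l) = μ) {r : ℕ} (hr : 0 < r) (m : ℕ) {c : ℝ} (hc : 1 ≤ c) :
    P {ω | Overshoot μ (fun l => Y l ω) r m c} ≤
      ENNReal.ofReal (Real.exp (-(m * (Real.log c - 1 + 1 / c)))) := by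
  have : IsProbabilityMeasure μ := hμ 0 ▸ Measure.isProbabilityMeasure_map (hY 0).aemeasurable
  have hg : Measurable ((tailSet μ (m / (r * c))).indicator (fun _ => (1 : ℝ))) :=
    measurable_const.indicator (measurableSet_tailSet _ _)
  refine measure_le_sum_le
    (Z := fun l ω => (tailSet μ (m / (r * c))).indicator (fun _ => (1 : ℝ)) (Y l ω))
    (fun l => hg.comp (hY l)) (hind.comp _ fun _ => hg) (fun l ω => ?_) (fun l ω => ?_) hc hr
    fun l => ?_
  · exact Set.indicator_nonneg (fun _ _ => zero_le_one) _
  · exact Set.indicator_le_self' (fun _ _ => zero_le_one) _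
  · rw [← integral_map (φ := Y l) (hY l).aemeasurable hg.aestronglyMeasurable, hμ,
      integral_indicator_const _ (measurableSet_tailSet _ _), smul_eq_mul, mul_one]
    have := measure_tailSet_le μ (m / (r * c))
    exact ENNReal.toReal_le_of_le_ofReal (by positivity) this

end Overshoot

/-! ### Summing the failure probabilities -/

/-- The summable sequence that bounds the probabilities of bad events. -/
noncomputable def decay (s : ℕ) : ℝ := (s : ℝ) ^ (-(6 / 5) : ℝ)

theorem decay_nonneg (s : ℕ) : 0 ≤ decay s := Real.rpow_nonneg (Nat.cast_nonneg s) _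

theorem summable_decay : Summable decay := Real.summable_nat_rpow.2 (by norm_num)

theorem decay_eq_exp {s : ℕ} (hs : 1 ≤ s) : decay s = Real.exp (-(6 / 5 * Real.log s)) := by
  rw [decay, Real.rpow_def_of_pos (by exact_mod_cast hs)]
  ring_nf

theorem sum_decay_le (F : Finset ℕ) : ∑ s ∈ F, decay s ≤ ∑' s, decay s :=
  summable_decay.sum_le_tsum _ fun _ _ => decay_nonneg _

theorem level_le_self {m r : ℕ} (hm : 1 ≤ m) (hmr : m ≤ r) : level ((m : ℝ) / r) ≤ r := by
  have hm' : (1 : ℝ) ≤ m := by exact_mod_cast hm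
  have hr' : (1 : ℝ) ≤ r := by exact_mod_cast hm.trans hmr
  have h1 := two_pow_level_le (p := (m : ℝ) / r) (by positivity)
    ((div_le_one (by linarith)).2 (by exact_mod_cast hmr))
  have h2 : (2 : ℝ) / (m / r) ≤ 2 * r := by
    rw [div_div_eq_mul_div]
    exact div_le_self (by positivity) hm'
  have h3 : 2 * r ≤ 2 ^ r := by
    obtain ⟨k, rfl⟩ : ∃ k, r = k + 1 := ⟨r - 1, by omega⟩
    have : k < 2 ^ k := Nat.lt_two_pow_self
    rw [pow_succ]; omega
  have h4 : (2 : ℝ) ^ level ((m : ℝ) / r) ≤ 2 ^ r := h1.trans (h2.trans (by exact_mod_cast h3))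
  exact (pow_le_pow_iff_right₀ (by norm_num)).1 h4

theorem width_sq_le_log {m r s : ℕ} (hm : 1 ≤ m) (hmr : m ≤ r) (hrs : r ≤ s) :
    m * width m r s ^ 2 ≤ 36 * Real.log s := by
  have hs : (0 : ℝ) < s := by exact_mod_cast (hm.trans (hmr.trans hrs))
  have hl : (0 : ℝ) < level ((m : ℝ) / r) := by exact_mod_cast one_le_level _
  have hls : (level ((m : ℝ) / r) : ℝ) ≤ s := by exact_mod_cast (level_le_self hm hmr).trans hrs
  refine (width_sq_le hm hmr).trans ?_
  have : Real.log (level ((m : ℝ) / r) * s) ≤ 2 * Real.log s := by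
    rw [two_mul, ← Real.log_mul hs.ne' hs.ne']
    gcongr
  linarith

/-- From ln (1 + e) ≥ 2 e / (2 + e). The denominator is 15/4 at e = 1/2 and 66/25 at e = 1/5;
dividing 9 by these gives the exponents 12/5 and (rounded down) 17/5 used below. -/
theorem le_rate {e : ℝ} (he : 0 ≤ e) :
    e ^ 2 / ((2 + e) * (1 + e)) ≤ Real.log (1 + e) - 1 + 1 / (1 + e) := by
  have h1 := Real.le_log_one_add_of_nonneg he
  have h2 : e ^ 2 / ((2 + e) * (1 + e)) = 2 * e / (e + 2) - 1 + 1 / (1 + e) := by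
    field_simp; ring
  linarith

theorem exp_neg_rate_le {m r s : ℕ} (hs : 1 ≤ s) (hm : 1 ≤ m) (hmr : m ≤ r) {b : ℝ}
    (hw : (2 + width m r s) * (1 + width m r s) * b ≤ 9) :
    Real.exp (-(m * (Real.log (1 + width m r s) - 1 + 1 / (1 + width m r s)))) ≤
      Real.exp (-(b * Real.log s)) := by
  have h0 := width_nonneg m r s
  rw [Real.exp_le_exp, neg_le_neg_iff]
  have h1 := log_le_width_sq hs hm hmr
  have hl := Real.log_natCast_nonneg s
  calc b * Real.log s ≤ 9 / ((2 + width m r s) * (1 + width m r s)) * Real.log s := by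
        gcongr
        rw [le_div_iff₀ (by positivity)]
        linarith
    _ = 9 * Real.log s / ((2 + width m r s) * (1 + width m r s)) := by ring
    _ ≤ m * width m r s ^ 2 / ((2 + width m r s) * (1 + width m r s)) := by gcongr
    _ = m * (width m r s ^ 2 / ((2 + width m r s) * (1 + width m r s))) := by ring
    _ ≤ _ := by gcongr; exact le_rate h0

/-- Some sample of at most `s` values overshoots. -/
def Bad (μ : Measure ℝ) (y : ℕ → ℝ) (s : ℕ) (c : ℕ → ℕ → ℝ) : Prop :=
  ∃ r ∈ Finset.Icc 1 s, ∃ m ∈ Finset.Icc 1 r, width m r s ≤ 1 / 2 ∧ Overshoot μ y r m (c r m)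

/-- There are about s² pairs (r, m), too many for the exponent 12/5. But a width above 1/5 forces m
≤ 900 ln s, and all other pairs enjoy the exponent 17/5. The remaining factor ln s is absorbed by
s^(1/5). -/
theorem sum_exp_neg_rate_le {s : ℕ} (hs : 2 ≤ s) :
    ∑ r ∈ Finset.Icc 1 s, ∑ m ∈ Finset.Icc 1 r,
      (if width m r s ≤ 1 / 2 then
        Real.exp (-(m * (Real.log (1 + width m r s) - 1 + 1 / (1 + width m r s)))) else 0) ≤
      4502 * decay s := by
  set L := Real.log s with hL
  have hL0 : 0 ≤ L := Real.log_natCast_nonneg s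
  have hs' : (0 : ℝ) < s := by positivity
  have hexp : Real.exp L = s := Real.exp_log hs'
  have hterm : ∀ r ∈ Finset.Icc 1 s, ∀ m ∈ Finset.Icc 1 r, (if width m r s ≤ 1 / 2 then
        Real.exp (-(m * (Real.log (1 + width m r s) - 1 + 1 / (1 + width m r s)))) else 0) ≤
      Real.exp (-(17 / 5 * L)) +
        if m ∈ Finset.Icc 1 ⌊900 * L⌋₊ then Real.exp (-(12 / 5 * L)) else 0 := by
    intro r hr m hm
    rw [Finset.mem_Icc] at hr hm
    have h0 := width_nonneg m r s
    have hpos : 0 ≤ if m ∈ Finset.Icc 1 ⌊900 * L⌋₊ then Real.exp (-(12 / 5 * L)) else 0 := by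
      split_ifs <;> positivity
    by_cases h1 : width m r s ≤ 1 / 2
    · rw [if_pos h1]
      by_cases h2 : width m r s ≤ 1 / 5
      · have := exp_neg_rate_le (b := 17 / 5) (by omega : 1 ≤ s) hm.1 hm.2 (by nlinarith)
        linarith
      · have h3 := width_sq_le_log hm.1 hm.2 hr.2
        have h4 : (m : ℝ) ≤ 900 * L := by
          have : (m : ℝ) * (1 / 5) ^ 2 ≤ m * width m r s ^ 2 := by
            gcongr; exact (not_le.1 h2).le
          linarith
        rw [if_pos (Finset.mem_Icc.2 ⟨hm.1, Nat.le_floor h4⟩)]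
        have := exp_neg_rate_le (b := 12 / 5) (by omega : 1 ≤ s) hm.1 hm.2 (by nlinarith)
        have := Real.exp_pos (-(17 / 5 * L))
        linarith
    · rw [if_neg h1]
      have := Real.exp_pos (-(17 / 5 * L))
      linarith
  have hrow : ∀ r ∈ Finset.Icc 1 s, ∑ m ∈ Finset.Icc 1 r, (if width m r s ≤ 1 / 2 then
        Real.exp (-(m * (Real.log (1 + width m r s) - 1 + 1 / (1 + width m r s)))) else 0) ≤
      (1 + 900 * L) * Real.exp (-(12 / 5 * L)) := by
    intro r hr
    have hrs : (r : ℝ) ≤ s := by exact_mod_cast (Finset.mem_Icc.1 hr).2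
    refine (Finset.sum_le_sum (hterm r hr)).trans ?_
    rw [Finset.sum_add_distrib, Finset.sum_const, Nat.card_Icc, ← Finset.sum_filter,
      Finset.sum_const, nsmul_eq_mul, nsmul_eq_mul, Nat.add_sub_cancel, add_mul, one_mul]
    refine add_le_add ?_ ?_
    · calc (r : ℝ) * Real.exp (-(17 / 5 * L)) ≤ Real.exp L * Real.exp (-(17 / 5 * L)) := by
            rw [hexp]; gcongr
        _ = Real.exp (-(12 / 5 * L)) := by rw [← Real.exp_add]; congr 1; ring
    · gcongr
      have h5 : ((Finset.Icc 1 r).filter fun m => m ∈ Finset.Icc 1 ⌊900 * L⌋₊).card ≤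
          ⌊900 * L⌋₊ := by
        refine (Finset.card_le_card fun m hm => (Finset.mem_filter.1 hm).2).trans ?_
        simp
      exact (Nat.cast_le.2 h5).trans (Nat.floor_le (by positivity))
  refine (Finset.sum_le_sum hrow).trans ?_
  rw [Finset.sum_const, Nat.card_Icc, nsmul_eq_mul, Nat.add_sub_cancel,
    decay_eq_exp (by omega), ← hL]
  have h1 : L / 5 + 1 ≤ Real.exp (L / 5) := Real.add_one_le_exp _
  have h2 : (1 : ℝ) ≤ Real.exp (L / 5) := Real.one_le_exp (by positivity)
  calc (s : ℝ) * ((1 + 900 * L) * Real.exp (-(12 / 5 * L)))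
      ≤ Real.exp L * ((4502 * Real.exp (L / 5)) * Real.exp (-(12 / 5 * L))) := by
        rw [hexp]; gcongr; linarith
    _ = 4502 * (Real.exp L * Real.exp (L / 5) * Real.exp (-(12 / 5 * L))) := by ring
    _ = 4502 * Real.exp (-(6 / 5 * L)) := by
        rw [← Real.exp_add, ← Real.exp_add]; congr 2; ring

theorem sum_exp_neg_mul_le {s : ℕ} (hs : 2 ≤ s) (j : ℕ) :
    s * Real.exp (j + 3) * ∑ r ∈ Finset.Icc 1 s, ∑ m ∈ Finset.Icc 1 r,
      (if width m r s ≤ 1 / 2 then Real.exp (-(m * ((j : ℝ) + 1))) else 0) ≤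
      decay s * (1 / 2) ^ j := by
  set L := Real.log s with hL
  have hL1 : 1 / 2 ≤ L := half_le_log_two.trans (log_two_le_log hs)
  have hs' : (0 : ℝ) < s := by positivity
  have hexp : Real.exp L = s := Real.exp_log hs'
  -- A width at most 1/2 forces m ≥ 36 ln s. In the exponent, j + 3 cancels the weight, j yields the
  -- factor (1/2) ^ j, and 18 L pays for s³ and for `decay`.
  have hterm : ∀ r ∈ Finset.Icc 1 s, ∀ m ∈ Finset.Icc 1 r, (if width m r s ≤ 1 / 2 then
        Real.exp (-(m * ((j : ℝ) + 1))) else 0) ≤ Real.exp (-(18 * L) - j - (j + 3)) := by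
    intro r hr m hm
    rw [Finset.mem_Icc] at hr hm
    split_ifs with h1
    · rw [Real.exp_le_exp]
      have h2 := log_le_width_sq (by omega : 1 ≤ s) hm.1 hm.2
      have h3 : (m : ℝ) * width m r s ^ 2 ≤ m * (1 / 2) ^ 2 := by
        gcongr; exact width_nonneg _ _ _
      have h4 : 36 * L ≤ m := by linarith
      have h5 : (0 : ℝ) ≤ j := by positivity
      nlinarith
    · positivity
  have hrow : ∀ r ∈ Finset.Icc 1 s, ∑ m ∈ Finset.Icc 1 r, (if width m r s ≤ 1 / 2 then
        Real.exp (-(m * ((j : ℝ) + 1))) else 0) ≤ s * Real.exp (-(18 * L) - j - (j + 3)) := by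
    intro r hr
    have hrs : (r : ℝ) ≤ s := by exact_mod_cast (Finset.mem_Icc.1 hr).2
    refine (Finset.sum_le_sum (hterm r hr)).trans ?_
    rw [Finset.sum_const, Nat.card_Icc, nsmul_eq_mul, Nat.add_sub_cancel]
    gcongr
  have hsum := Finset.sum_le_sum hrow
  rw [Finset.sum_const, Nat.card_Icc, nsmul_eq_mul, Nat.add_sub_cancel] at hsum
  refine (mul_le_mul_of_nonneg_left hsum (by positivity)).trans ?_
  rw [decay_eq_exp (by omega), ← hL]
  have h2 : Real.exp (-(j : ℝ)) ≤ (1 / 2) ^ j := by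
    rw [show -(j : ℝ) = j * (-1) by ring, Real.exp_nat_mul]
    have h3 : Real.exp (-1) ≤ 1 / 2 := by
      rw [Real.exp_neg, one_div]
      have := Real.add_one_le_exp 1
      gcongr; linarith
    gcongr
  calc (s : ℝ) * Real.exp (j + 3) * (s * (s * Real.exp (-(18 * L) - j - (j + 3))))
      = Real.exp L * Real.exp (j + 3) *
          (Real.exp L * (Real.exp L * Real.exp (-(18 * L) - j - (j + 3)))) := by rw [hexp]
    _ = Real.exp (-(15 * L)) * Real.exp (-j) := by
        simp only [← Real.exp_add]; congr 1; ring
    _ ≤ _ := by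
        gcongr
        linarith

/-! ### Quantiles -/

section Quantile

variable {μ : Measure ℝ} [IsProbabilityMeasure μ]

theorem measure_Ioi_eq_one {κ₀ x : ℝ} (hκ : ∀ᵐ z ∂μ, κ₀ ≤ z) (hx : x < κ₀) :
    μ (Set.Ioi x) = 1 := by
  rw [prob_compl_eq_zero_iff measurableSet_Ioi |>.symm]
  refine measure_mono_null (fun z hz => ?_) (ae_iff.1 hκ)
  simp only [Set.mem_compl_iff, Set.mem_Ioi, not_lt] at hz
  exact not_le.2 (hz.trans_lt hx)

/-- Take the infimum of `tailSet μ δ`: points above it have tail at most δ, rationals below it have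
tail more than δ. The law may have an atom at y, so the open tail (for the definition of optimality)
and the closed one (for counting samples) are both needed. -/
theorem exists_quantile {κ₀ δ : ℝ} (hκ : ∀ᵐ z ∂μ, κ₀ ≤ z) (hδ : 0 < δ) (hδ1 : δ < 1) :
    ∃ y, κ₀ ≤ y ∧ μ (Set.Ioi y) ≤ ENNReal.ofReal δ ∧ δ ≤ μ.real (Set.Ici y) := by
  have hne : (tailSet μ δ).Nonempty := by
    have h1 := (tendsto_cdf_atTop μ).comp tendsto_natCast_atTop_atTop
    obtain ⟨n, hn⟩ := (h1.eventually (lt_mem_nhds (by linarith : 1 - δ < 1))).exists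
    simp only [Function.comp_apply, cdf_eq_real] at hn
    have h2 := probReal_add_probReal_compl (μ := μ) (measurableSet_Iic (a := (n : ℝ)))
    rw [Set.compl_Iic] at h2
    exact Set.nonempty_of_mem (Ioi_subset_tailSet (q := δ) (by linarith)
      (Set.mem_Ioi.2 (lt_add_one (n : ℝ))))
  have hlb : ∀ z ∈ tailSet μ δ, κ₀ ≤ z := by
    intro z hz
    obtain ⟨⟨x, hx⟩, hxz⟩ := Set.mem_iUnion.1 hz
    by_contra! hlt
    rw [measureReal_def, measure_Ioi_eq_one hκ ((Set.mem_Ioi.1 hxz).trans hlt)] at hx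
    simp only [ENNReal.toReal_one] at hx
    linarith
  refine ⟨sInf (tailSet μ δ), le_csInf hne hlb, ?_, ?_⟩
  · refine (measure_mono fun z hz => ?_).trans (measure_tailSet_le μ δ)
    obtain ⟨w, hw, hwz⟩ := exists_lt_of_csInf_lt hne (Set.mem_Ioi.1 hz)
    obtain ⟨x, hxw⟩ := Set.mem_iUnion.1 hw
    exact Set.mem_iUnion.2 ⟨x, (Set.mem_Ioi.1 hxw).trans hwz⟩
  · have h1 : Set.Iio (sInf (tailSet μ δ)) ⊆
        ⋃ x : {x : ℚ // (x : ℝ) < sInf (tailSet μ δ)}, Set.Iic ((x : ℚ) : ℝ) := fun z hz => by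
      obtain ⟨x, h1, h2⟩ := exists_rat_btwn (Set.mem_Iio.1 hz)
      exact Set.mem_iUnion.2 ⟨⟨x, h2⟩, h1.le⟩
    have h2 : μ (Set.Iio (sInf (tailSet μ δ))) ≤ ENNReal.ofReal (1 - δ) := by
      refine (measure_mono h1).trans ?_
      rw [Directed.measure_iUnion]
      · refine iSup_le fun x => ?_
        rw [← ofReal_measureReal]
        refine ENNReal.ofReal_le_ofReal ?_
        have h2 := probReal_add_probReal_compl (μ := μ) (measurableSet_Iic (a := ((x : ℚ) : ℝ)))
        rw [Set.compl_Iic] at h2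
        by_contra! hlt
        have h3 := Ioi_subset_tailSet (μ := μ) (q := δ) (x := ((x : ℚ) : ℝ)) (by linarith)
        have h4 := csInf_le_csInf ⟨κ₀, fun z hz => hlb z hz⟩ Set.nonempty_Ioi h3
        rw [csInf_Ioi] at h4
        exact absurd x.2 (not_lt.2 h4)
      · intro x y
        rcases le_total x.1 y.1 with h | h
        · exact ⟨y, Set.Iic_subset_Iic.2 (by exact_mod_cast h), subset_rfl⟩
        · exact ⟨x, subset_rfl, Set.Iic_subset_Iic.2 (by exact_mod_cast h)⟩
    have h3 := probReal_add_probReal_compl (μ := μ) (measurableSet_Iio (a := sInf (tailSet μ δ)))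
    rw [Set.compl_Iio] at h3
    have h4 := ENNReal.toReal_le_of_le_ofReal (by linarith) h2
    rw [← measureReal_def] at h4
    linarith

end Quantile

/-! ### Upper bounds on the confidence bound -/

section Upper

variable {μ : Measure ℝ} [IsProbabilityMeasure μ]

theorem sampleLcb_le {y : ℕ → ℝ} {r s : ℕ} (hs : 1 ≤ s) {D m : ℝ} (hD : 0 ≤ D) (hm : 0 ≤ m)
    (hmean : ∫⁻ x in Set.Ioi (0 : ℝ), μ (Set.Ioi x) = ENNReal.ofReal m)
    (h : ∀ x, beta ((tailCount y r x : ℝ) / r) r s ≤ D * μ.real (Set.Ioi x)) :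
    sampleLcb y r s ≤ D * m := by
  rw [← ENNReal.ofReal_le_ofReal_iff (by positivity), ofReal_sampleLcb y r hs,
    ENNReal.ofReal_mul hD, ← hmean, ← lintegral_const_mul' _ _ ENNReal.ofReal_ne_top]
  refine lintegral_mono fun x => ?_
  refine (ENNReal.ofReal_le_ofReal (h x)).trans ?_
  rw [ENNReal.ofReal_mul hD, ofReal_measureReal]

/-- The condition `h` is abstract because it is used twice: for c = 1 + width and D = 1 the scaling
in `beta` cancels the overshoot exactly; for constant c = D the scaling is discarded. -/
theorem sampleLcb_le_of_not_bad {y : ℕ → ℝ} {r s : ℕ} (hs : 1 ≤ s) (hrs : r ≤ s) {D m : ℝ}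
    {c : ℕ → ℕ → ℝ}
    (hc : ∀ r m, 0 < c r m) (hD : 0 ≤ D) (hm : 0 ≤ m)
    (hmean : ∫⁻ x in Set.Ioi (0 : ℝ), μ (Set.Ioi x) = ENNReal.ofReal m)
    (hbad : ¬ Bad μ y s c)
    (h : ∀ k p : ℝ, ∀ n : ℕ, 0 ≤ k → k ≤ c r n * p → k / (1 + width n r s) ≤ D * p) :
    sampleLcb y r s ≤ D * m := by
  refine sampleLcb_le hs hD hm hmean fun x => ?_
  have hp : 0 ≤ μ.real (Set.Ioi x) := measureReal_nonneg
  unfold beta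
  split_ifs with hif
  · rcases Nat.eq_zero_or_pos (tailCount y r x) with h0 | h0
    · rw [h0]; simp only [Nat.cast_zero, zero_div]; positivity
    · refine h _ _ (tailCount y r x) (by positivity)
        (tailCount_div_le_of_not_overshoot (hc _ _) fun hov => hbad ?_)
      exact ⟨r, Finset.mem_Icc.2 ⟨hif.1, hrs⟩, _, Finset.mem_Icc.2 ⟨h0, tailCount_le _ _ _⟩,
        hif.2, hov⟩
  · positivity

end Upper

/-! ### Probabilities of the bad events -/

section BadEvents

theorem setOf_bad_eq {Ω : Type*} (μ : Measure ℝ) (Y : ℕ → Ω → ℝ) (s : ℕ) (c : ℕ → ℕ → ℝ) :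
    {ω | Bad μ (fun l => Y l ω) s c} = ⋃ r ∈ Finset.Icc 1 s, ⋃ m ∈ Finset.Icc 1 r,
      {ω | width m r s ≤ 1 / 2 ∧ Overshoot μ (fun l => Y l ω) r m (c r m)} := by
  ext ω; simp only [Bad, Set.mem_iUnion, exists_prop, Set.mem_ofPred_eq]

variable {μ : Measure ℝ} {Ω : Type*} [MeasurableSpace Ω] {P : Measure Ω} [IsProbabilityMeasure P]
  {Y : ℕ → Ω → ℝ}

theorem measurableSet_bad (hY : ∀ l, Measurable (Y l)) (s : ℕ) (c : ℕ → ℕ → ℝ) :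
    MeasurableSet {ω | Bad μ (fun l => Y l ω) s c} := by
  rw [setOf_bad_eq]
  refine Finset.measurableSet_biUnion _ fun r _ => Finset.measurableSet_biUnion _ fun m _ => ?_
  exact (MeasurableSet.const _).inter (measurableSet_overshoot hY r m _)

theorem measure_bad_le (hY : ∀ l, Measurable (Y l)) (hind : iIndepFun Y P)
    (hμ : ∀ l, P.map (Y l) = μ) (s : ℕ) {c : ℕ → ℕ → ℝ} (hc : ∀ r m, 1 ≤ c r m) :
    P {ω | Bad μ (fun l => Y l ω) s c} ≤ ENNReal.ofReal
      (∑ r ∈ Finset.Icc 1 s, ∑ m ∈ Finset.Icc 1 r, if width m r s ≤ 1 / 2 then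
        Real.exp (-(m * (Real.log (c r m) - 1 + 1 / c r m))) else 0) := by
  have h0 : ∀ r m : ℕ, 0 ≤ if width m r s ≤ 1 / 2 then
      Real.exp (-(m * (Real.log (c r m) - 1 + 1 / c r m))) else 0 := fun r m => by
    split_ifs <;> positivity
  rw [setOf_bad_eq, ENNReal.ofReal_sum_of_nonneg fun r _ => Finset.sum_nonneg fun m _ => h0 r m]
  refine (measure_biUnion_finset_le _ _).trans (Finset.sum_le_sum fun r hr => ?_)
  rw [ENNReal.ofReal_sum_of_nonneg fun m _ => h0 r m]
  refine (measure_biUnion_finset_le _ _).trans (Finset.sum_le_sum fun m _ => ?_)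
  split_ifs with h
  · refine (measure_mono fun ω hω => ?_).trans
      (measure_overshoot_le hY hind hμ (Finset.mem_Icc.1 hr).1 m (hc r m))
    exact hω.2
  · refine (measure_mono_null (t := ∅) (fun ω hω => ?_) measure_empty).le.trans zero_le
    exact h hω.1

theorem measure_bad_one_add_width_le (hY : ∀ l, Measurable (Y l)) (hind : iIndepFun Y P)
    (hμ : ∀ l, P.map (Y l) = μ) {s : ℕ} (hs : 2 ≤ s) :
    P {ω | Bad μ (fun l => Y l ω) s fun r m => 1 + width m r s} ≤
      ENNReal.ofReal (4502 * decay s) :=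
  (measure_bad_le hY hind hμ s fun _ _ => le_add_of_nonneg_right (width_nonneg _ _ _)).trans
    (ENNReal.ofReal_le_ofReal (sum_exp_neg_rate_le hs))

theorem measure_bad_exp_le (hY : ∀ l, Measurable (Y l)) (hind : iIndepFun Y P)
    (hμ : ∀ l, P.map (Y l) = μ) {s : ℕ} (hs : 2 ≤ s) (j : ℕ) :
    ENNReal.ofReal (s * Real.exp (j + 3)) *
      P {ω | Bad μ (fun l => Y l ω) s fun _ _ => Real.exp (j + 2)} ≤
      ENNReal.ofReal (decay s) * (1 / 2) ^ j := by
  have h1 := measure_bad_le hY hind hμ s (c := fun _ _ => Real.exp (j + 2))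
    fun r m => Real.one_le_exp (by positivity)
  refine (mul_le_mul_right h1 _).trans ?_
  rw [← ENNReal.ofReal_mul (by positivity)]
  have h2 : ENNReal.ofReal (decay s) * (1 / 2) ^ j = ENNReal.ofReal (decay s * (1 / 2) ^ j) := by
    rw [ENNReal.ofReal_mul (decay_nonneg s), ENNReal.ofReal_pow (by norm_num),
      ENNReal.ofReal_div_of_pos (by norm_num)]
    simp
  rw [h2]
  refine ENNReal.ofReal_le_ofReal (le_trans ?_ (sum_exp_neg_mul_le hs j))
  gcongr with r _ m _
  split_ifs with h
  · rw [Real.exp_le_exp, neg_le_neg_iff, Real.log_exp]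
    refine mul_le_mul_of_nonneg_left ?_ (Nat.cast_nonneg _)
    have : 0 < 1 / Real.exp ((j : ℝ) + 2) := by positivity
    linarith
  · exact le_rfl

/-- The sample of the first `r` values has too little mass around the quantile `q`. -/
def Low (y : ℕ → ℝ) (r : ℕ) (q δ M η : ℝ) : Prop :=
  (((Finset.range r).filter fun l => q ≤ y l).card : ℝ) < (1 - η) * (r * δ) ∨
    ∑ l ∈ Finset.range r, min (y l) q < (1 - η) * (r * M)

theorem setOf_low_eq {Ω : Type*} (Y : ℕ → Ω → ℝ) (r : ℕ) (q δ M η : ℝ) :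
    {ω | Low (fun l => Y l ω) r q δ M η} =
      {ω | ∑ l ∈ Finset.range r, (Set.Ici q).indicator (fun _ => (1 : ℝ)) (Y l ω) <
          (1 - η) * (r * δ)} ∪
      {ω | ∑ l ∈ Finset.range r, min (Y l ω) q < (1 - η) * (r * M)} := by
  ext ω
  simp only [Low, Set.mem_union, Set.mem_ofPred_eq, Finset.card_filter, Nat.cast_sum]
  have : ∀ l, (Set.Ici q).indicator (fun _ => (1 : ℝ)) (Y l ω) =
      ((if q ≤ Y l ω then 1 else 0 : ℕ) : ℝ) := fun l => by
    by_cases h : q ≤ Y l ω <;> simp [h]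
  simp only [this]

theorem measurableSet_low (hY : ∀ l, Measurable (Y l)) (r : ℕ) (q δ M η : ℝ) :
    MeasurableSet {ω | Low (fun l => Y l ω) r q δ M η} := by
  rw [setOf_low_eq]
  refine (measurableSet_lt (Finset.measurable_sum _ fun l _ => ?_) measurable_const).union
    (measurableSet_lt (Finset.measurable_sum _ fun l _ => ?_) measurable_const)
  · exact (measurable_const.indicator measurableSet_Ici).comp (hY l)
  · exact (hY l).min measurable_const

theorem measure_low_le (hY : ∀ l, Measurable (Y l)) (hind : iIndepFun Y P)
    (hμ : ∀ l, P.map (Y l) = μ) (hY0 : ∀ l ω, 0 ≤ Y l ω) (r : ℕ) {q δ M η : ℝ} (hq : 0 < q)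
    (hδ : 0 ≤ δ) (hη : 0 ≤ η) (hqδ : δ ≤ μ.real (Set.Ici q)) (hM : M = ∫ z, min z q ∂μ)
    (hMδ : q * δ ≤ M) :
    P {ω | Low (fun l => Y l ω) r q δ M η} ≤
      2 * ENNReal.ofReal (Real.exp (-(r * δ * η ^ 2 / 2))) := by
  rw [setOf_low_eq, two_mul]
  refine (measure_union_le _ _).trans (add_le_add ?_ ?_)
  · have hg : Measurable ((Set.Ici q).indicator (fun _ => (1 : ℝ))) :=
      measurable_const.indicator measurableSet_Ici
    refine measure_sum_lt_le (Z := fun l ω => (Set.Ici q).indicator (fun _ => (1 : ℝ)) (Y l ω))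
      (fun l => hg.comp (hY l)) (hind.comp _ fun _ => hg)
      (fun l ω => Set.indicator_nonneg (fun _ _ => zero_le_one) _)
      (fun l ω => Set.indicator_le_self' (fun _ _ => zero_le_one) _) hη hδ fun l => ?_
    rw [← integral_map (φ := Y l) (hY l).aemeasurable hg.aestronglyMeasurable, hμ,
      integral_indicator_const _ measurableSet_Ici, smul_eq_mul, mul_one]
    exact hqδ
  · have hg : Measurable fun z : ℝ => min z q / q := by fun_prop
    -- Divided by q, the capped values lie in [0, 1] and have mean at least δ, so the capped sum
    -- deviates no more easily than the count.
    have hM0 : δ ≤ M / q := by rw [le_div_iff₀ hq]; linarith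
    have h1 := measure_sum_lt_le (P := P) (Z := fun l ω => min (Y l ω) q / q) (q := M / q) (r := r)
      (fun l => hg.comp (hY l)) (hind.comp _ fun _ => hg)
      (fun l ω => div_nonneg (le_min (hY0 l ω) hq.le) hq.le)
      (fun l ω => div_le_one_of_le₀ (min_le_right _ _) hq.le) hη (hδ.trans hM0) fun l => by
        rw [← integral_map (φ := Y l) (f := fun z => min z q / q) (hY l).aemeasurable
          hg.aestronglyMeasurable, hμ, integral_div, hM]
    have h2 : {ω | ∑ l ∈ Finset.range r, min (Y l ω) q < (1 - η) * (r * M)} =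
        {ω | ∑ l ∈ Finset.range r, min (Y l ω) q / q < (1 - η) * (r * (M / q))} := by
      ext ω
      simp only [Set.mem_ofPred_eq]
      rw [← Finset.sum_div, div_lt_iff₀ hq]
      have : (1 - η) * (r * (M / q)) * q = (1 - η) * (r * M) := by field_simp
      rw [this]
    rw [h2]
    refine h1.trans (ENNReal.ofReal_le_ofReal (Real.exp_le_exp.2 (neg_le_neg ?_)))
    gcongr

end BadEvents

/-! ### Pathwise bounds in terms of bad events -/

section Pathwise

variable {N : Type*} {κ₀ : ℝ} {x : N → ℕ → ℝ} {a : ℕ → N} {μ : Measure ℝ} [IsProbabilityMeasure μ]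

theorem lcb_states_le_of_not_bad (hκ : 0 < κ₀) (hx : ∀ k l, κ₀ ≤ x k l) {k : N} {n : ℕ} {D m : ℝ}
    {c : ℕ → ℕ → ℝ} (hc : ∀ r m, 0 < c r m) (hD : 0 ≤ D) (hm : 0 ≤ m)
    (hmean : ∫⁻ y in Set.Ioi (0 : ℝ), μ (Set.Ioi y) = ENNReal.ofReal m)
    (hbad : ¬ Bad μ (x k) (n + 1) c)
    (h : ∀ y z : ℝ, ∀ r j : ℕ, 0 ≤ y → y ≤ c r j * z → y / (1 + width j r (n + 1)) ≤ D * z) :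
    (states κ₀ x a n k).lcb (n + 1) ≤ D * m := by
  rw [TesterState.lcb_eq]
  -- Recorded outcomes are at most the true running times, so truncation only lowers the bound.
  refine (sampleLcb_mono (by omega) (states_inv hκ hx n k).obs_le).trans ?_
  exact sampleLcb_le_of_not_bad (by omega) ((numActive_states_le n k).trans (Nat.le_succ n)) hc hD
    hm hmean hbad fun y z j => h y z _ j

/-- The gap 1 + ε outweighs all three losses: (1 - ε/6)² (1 + ε) ≥ 1 + ε/6 for ε ≤ 1. -/
theorem lt_shrink_mul {ε m M : ℝ} (hε : 0 < ε) (hε1 : ε ≤ 1) (hm : 0 < m) (hM : (1 + ε) * m < M) :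
    m < (1 - ε / 6) ^ 2 / (1 + ε / 6) * M := by
  have h1 : 1 ≤ (1 - ε / 6) ^ 2 / (1 + ε / 6) * (1 + ε) := by
    rw [div_mul_eq_mul_div, one_le_div (by positivity)]
    nlinarith [mul_pos hε hε, mul_nonneg hε.le (sub_nonneg.2 hε1),
      mul_nonneg (mul_pos hε hε).le (sub_nonneg.2 hε1)]
  have h2 : 0 < (1 - ε / 6) ^ 2 / (1 + ε / 6) := by
    have : 0 < 1 - ε / 6 := by linarith
    positivity
  calc m ≤ (1 - ε / 6) ^ 2 / (1 + ε / 6) * (1 + ε) * m := le_mul_of_one_le_left hm.le h1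
    _ = (1 - ε / 6) ^ 2 / (1 + ε / 6) * ((1 + ε) * m) := by ring
    _ < _ := by gcongr

variable {i iStar : N} {t : ℕ} {q δ ε m M : ℝ}

/-- On every path of the algorithm, the number of active instances is bounded in terms of the number
of bad events. -/
theorem numActive_states_le_of_isRun (hκ : 0 < κ₀) (hx : ∀ k l, κ₀ ≤ x k l)
    (ha : IsRun κ₀ x a) (hm : 0 < m)
    (hmean : ∫⁻ y in Set.Ioi (0 : ℝ), μ (Set.Ioi y) = ENNReal.ofReal m)
    (hq : 0 < q) (hδ : 0 < δ) (hε : 0 < ε) (hε1 : ε ≤ 1) (hM : (1 + ε) * m < M)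
    {b b' : ℕ → ℝ} (hb : ∀ s, 0 ≤ b s) (hb' : ∀ r, 0 ≤ b' r)
    (hb1 : ∀ s, 2 ≤ s → Bad μ (x iStar) s (fun r j => 1 + width j r s) → 1 ≤ b s)
    (hb1' : ∀ r : ℕ, 1 ≤ r → 2592 / (ε ^ 2 * δ) * Real.log r ≤ r →
      Low (x i) r q δ M (ε / 6) → 1 ≤ b' r) :
    ∀ n ≤ t, ((states κ₀ x a n i).numActive : ℝ) ≤ 2592 / (ε ^ 2 * δ) * Real.log n + 1 +
      (∑ s ∈ Finset.range (t + 1), b s + ∑ r ∈ Finset.range t, b' r) := by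
  intro n hn
  have h := numActive_states_le_of_charge (κ₀ := κ₀) (x := x) (a := a) (i := i)
    (ρ := 2592 / (ε ^ 2 * δ)) (by positivity) hb hb' (t := t) (fun n hn1 hnt hi hr hlarge => by
      by_contra! hcon
      have hbad : ¬ Bad μ (x iStar) (n + 1) (fun r j => 1 + width j r (n + 1)) := fun hbad =>
        absurd (hb1 _ (by omega) hbad) (not_le.2 hcon.1)
      have hrn : (states κ₀ x a n i).numActive ≤ n := numActive_states_le n i
      have hlow : ¬ Low (x i) (states κ₀ x a n i).numActive q δ M (ε / 6) := fun hlow => by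
        refine absurd (hb1' _ hr (le_trans ?_ hlarge) hlow) (not_le.2 hcon.2)
        exact mul_le_mul_of_nonneg_left (log_natCast_mono (by omega)) (by positivity)
      simp only [Low, not_or, not_lt] at hlow
      have h1 := (states_inv (a := a) hκ hx n i).le_lcb hκ (hx i) (by omega : 2 ≤ n + 1)
        (by omega) (length_queue_states_le n i) hq hε hε1 (by
          rw [div_mul_eq_mul_div, div_le_iff₀ (by positivity)] at hlarge
          linarith) hlow.1 hlow.2
      have h2 : (states κ₀ x a n iStar).lcb (n + 1) ≤ 1 * m :=
        lcb_states_le_of_not_bad hκ hx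
          (fun r j => add_pos_of_pos_of_nonneg one_pos (width_nonneg _ _ _))
          zero_le_one hm.le hmean hbad fun y z r j _ hy => by
            have := width_nonneg j r (n + 1)
            rw [div_le_iff₀ (by linarith)]; linarith
      have h3 := ha n iStar
      rw [← hi] at h3
      -- Without a charge the bound of `i` exceeds m while that of `iStar` does not, contradicting
      -- the selection of `i`.
      have h4 := lt_shrink_mul hε hε1 hm hM
      linarith) n hn
  refine h.trans ?_
  have h1 : ∑ s ∈ Finset.range (n + 1), b s ≤ ∑ s ∈ Finset.range (t + 1), b s :=
    Finset.sum_le_sum_of_subset_of_nonneg (Finset.range_mono (by omega)) fun s _ _ => hb s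
  have h2 : ∑ r ∈ Finset.range (states κ₀ x a n i).numActive, b' r ≤ ∑ r ∈ Finset.range t, b' r :=
    Finset.sum_le_sum_of_subset_of_nonneg
      (Finset.range_mono ((numActive_states_le n i).trans hn)) fun s _ _ => hb' s
  linarith

/-- On every path of the algorithm, the total time is bounded in terms of the bad events. -/
theorem time_states_le_of_isRun (hκ : 0 < κ₀) (hx : ∀ k l, κ₀ ≤ x k l)
    (ha : IsRun κ₀ x a) (hm : κ₀ ≤ m)
    (hmean : ∫⁻ y in Set.Ioi (0 : ℝ), μ (Set.Ioi y) = ENNReal.ofReal m) (ht : 2 ≤ t)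
    {ρ K W : ℝ} (hρ : 1 ≤ ρ) (hK : 0 ≤ K) (hW : 0 ≤ W)
    (hr : ∀ n ≤ t, ((states κ₀ x a n i).numActive : ℝ) ≤ ρ * Real.log n + 1 + K)
    (hJ : ∀ s, 2 ≤ s → s ≤ t → ∃ j : ℕ, ¬ Bad μ (x iStar) s (fun _ _ => Real.exp (j + 2)) ∧
      s * (Real.exp (j + 2) - Real.exp 2) ≤ W) :
    (states κ₀ x a t i).time ≤ 2295 * Real.exp 2 * m * Real.log t * (ρ + K + W) := by
  have hm0 := hκ.trans_le hm
  refine time_states_le hκ hx ht hρ (Real.one_le_exp (by norm_num)) hK hW hm hr ?_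
  intro n hn1 hnt hi
  obtain ⟨j, hj1, hj2⟩ := hJ (n + 1) (by omega) hnt
  have h1 : (states κ₀ x a n iStar).lcb (n + 1) ≤ Real.exp (j + 2) * m :=
    lcb_states_le_of_not_bad hκ hx (fun _ _ => Real.exp_pos _) (Real.exp_pos _).le hm0.le hmean hj1
      fun y z r k hy0 hy => (div_le_self hy0
        (le_add_of_nonneg_right (width_nonneg k r (n + 1)))).trans hy
  have h2 := ha n iStar
  rw [← hi] at h2
  -- In the excess term the number of active instances is replaced by the iteration number, so that
  -- no product of K and W arises.
  have h3 : ((states κ₀ x a n i).numActive : ℝ) ≤ (n + 1 : ℕ) := by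
    exact_mod_cast (numActive_states_le n i).trans (Nat.le_succ n)
  have h4 : 0 ≤ Real.exp (j + 2) - Real.exp 2 :=
    sub_nonneg.2 (Real.exp_le_exp.2 (by linarith [Nat.cast_nonneg (α := ℝ) j]))
  calc ((states κ₀ x a n i).numActive : ℝ) * (states κ₀ x a n i).lcb (n + 1)
      ≤ (states κ₀ x a n i).numActive * (Real.exp (j + 2) * m) := by gcongr; exact h2.trans h1
    _ = m * (Real.exp 2 * (states κ₀ x a n i).numActive +
          (states κ₀ x a n i).numActive * (Real.exp (j + 2) - Real.exp 2)) := by ring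
    _ ≤ m * (Real.exp 2 * (states κ₀ x a n i).numActive +
          (n + 1 : ℕ) * (Real.exp (j + 2) - Real.exp 2)) := by gcongr
    _ ≤ _ := by gcongr

end Pathwise

/-! ### Integrating the excess -/

section Expectation

/-- The lower bound on `B(t, ε, δ)` that the hypothesis on `t` provides. -/
theorem le_bound {t : ℕ} {ε δ : ℝ} (ht : 2 ≤ t) (hδ : 0 < δ) (hδ1 : δ < 1)
    (h : 1 ≤ t * (Real.logb 2 (1 / δ)) ^ 2) :
    (ε ^ 2)⁻¹ * δ⁻¹ * (Real.log t / 2) ≤ bound t ε δ := by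
  unfold bound
  have ht' : (2 : ℝ) ≤ t := by exact_mod_cast ht
  have hl : 0 < Real.logb 2 (1 / δ) :=
    Real.logb_pos (by norm_num) ((one_lt_div hδ).2 hδ1)
  refine mul_le_mul_of_nonneg_left ?_ (by positivity)
  set l := Real.logb 2 (1 / δ)
  -- The hypothesis t l² ≥ 1 says exactly this, and it yields ln t ≤ 2 ln (t l).
  have h1 : (t : ℝ) ≤ (t * l) ^ 2 := by nlinarith
  have h2 : Real.log t ≤ 2 * Real.log (t * l) := by
    have := Real.log_le_log (by linarith) h1
    rwa [Real.log_pow, Nat.cast_ofNat] at this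
  have h3 : 0 ≤ Real.log t := Real.log_natCast_nonneg t
  have h4 : Real.log (t * l) ≤ Real.logb 2 (t * l) := by
    rw [Real.logb, le_div_iff₀ (Real.log_pos (by norm_num))]
    have := Real.log_two_lt_d9
    nlinarith
  linarith

variable {Ω : Type*}

/-- The excess of the lower confidence bounds up to time `t`. -/
noncomputable def excess (μ : Measure ℝ) (Y : ℕ → Ω → ℝ) (t : ℕ) (ω : Ω) : ℝ≥0∞ :=
  ∑ s ∈ Finset.Icc 2 t, ∑' j : ℕ, ENNReal.ofReal (s * Real.exp (j + 3)) *
    {ω | Bad μ (fun l => Y l ω) s fun _ _ => Real.exp (j + 2)}.indicator 1 ω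

/-- Take the least j that is not bad. If it is positive, level j - 1 is bad and contributes s
e^(j+2) to the excess. If all levels were bad, the excess would be infinite. -/
theorem exists_not_bad_of_excess_ne_top {μ : Measure ℝ} {Y : ℕ → Ω → ℝ} {t : ℕ} {ω : Ω}
    (h : excess μ Y t ω ≠ ⊤) {s : ℕ} (hs : 2 ≤ s) (hst : s ≤ t) :
    ∃ j : ℕ, ¬ Bad μ (fun l => Y l ω) s (fun _ _ => Real.exp (j + 2)) ∧
      s * (Real.exp (j + 2) - Real.exp 2) ≤ (excess μ Y t ω).toReal := by
  classical
  have hle : ∀ j : ℕ, Bad μ (fun l => Y l ω) s (fun _ _ => Real.exp (j + 2)) →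
      s * Real.exp (j + 3) ≤ (excess μ Y t ω).toReal := by
    intro j hj
    rw [← ENNReal.ofReal_le_iff_le_toReal h]
    refine le_trans ?_ (Finset.single_le_sum (fun _ _ => zero_le)
      (Finset.mem_Icc.2 ⟨hs, hst⟩))
    refine le_trans ?_ (ENNReal.le_tsum j)
    rw [Set.indicator_of_mem (by exact hj), Pi.one_apply, mul_one]
  have hex : ∃ j : ℕ, ¬ Bad μ (fun l => Y l ω) s (fun _ _ => Real.exp (j + 2)) := by
    by_contra! hall
    obtain ⟨j, hj⟩ := exists_nat_gt (excess μ Y t ω).toReal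
    have h1 := hle j (hall j)
    have h2 := Real.add_one_le_exp ((j : ℝ) + 3)
    have h3 : (2 : ℝ) ≤ s := by exact_mod_cast hs
    nlinarith
  refine ⟨Nat.find hex, Nat.find_spec hex, ?_⟩
  rcases hj : Nat.find hex with _ | j
  · simp
  · have h1 : Bad μ (fun l => Y l ω) s (fun _ _ => Real.exp (j + 2)) := by
      have := Nat.find_min hex (m := j) (by omega)
      exact not_not.1 this
    refine le_trans ?_ (hle j h1)
    have h2 : ((j + 1 : ℕ) : ℝ) + 2 = j + 3 := by push_cast; ring
    rw [h2]
    have := Real.exp_pos 2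
    gcongr
    linarith

variable [MeasurableSpace Ω] {P : Measure Ω}

theorem measurable_excess {μ : Measure ℝ} {Y : ℕ → Ω → ℝ} (hY : ∀ l, Measurable (Y l)) (t : ℕ) :
    Measurable (excess μ Y t) := by
  refine Finset.measurable_sum _ fun s _ => Measurable.tsum fun j => ?_
  exact (measurable_one.indicator (measurableSet_bad hY s _)).const_mul _

theorem lintegral_excess_le [IsProbabilityMeasure P] {μ : Measure ℝ} {Y : ℕ → Ω → ℝ}
    (hY : ∀ l, Measurable (Y l)) (hind : iIndepFun Y P) (hμ : ∀ l, P.map (Y l) = μ) (t : ℕ) :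
    ∫⁻ ω, excess μ Y t ω ∂P ≤ ENNReal.ofReal (2 * ∑' s, decay s) := by
  have hmeas : ∀ s j : ℕ, Measurable fun ω => ENNReal.ofReal (s * Real.exp (j + 3)) *
      {ω | Bad μ (fun l => Y l ω) s fun _ _ => Real.exp (j + 2)}.indicator 1 ω := fun s j =>
    (measurable_one.indicator (measurableSet_bad hY s _)).const_mul _
  simp only [excess]
  rw [lintegral_finsetSum _ fun s _ => Measurable.tsum fun j => hmeas s j]
  have h1 : ∀ s ∈ Finset.Icc 2 t, ∫⁻ ω, ∑' j : ℕ, ENNReal.ofReal (s * Real.exp (j + 3)) *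
      {ω | Bad μ (fun l => Y l ω) s fun _ _ => Real.exp (j + 2)}.indicator 1 ω ∂P ≤
      ENNReal.ofReal (2 * decay s) := by
    intro s hs
    rw [lintegral_tsum fun j => (hmeas s j).aemeasurable]
    calc _ ≤ ∑' j : ℕ, ENNReal.ofReal (decay s) * (1 / 2) ^ j := by
          refine ENNReal.tsum_le_tsum fun j => ?_
          rw [lintegral_const_mul' _ _ ENNReal.ofReal_ne_top,
            lintegral_indicator_one (measurableSet_bad hY s _)]
          exact measure_bad_exp_le hY hind hμ (Finset.mem_Icc.1 hs).1 j
      _ = _ := by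
          simp_rw [one_div]
          rw [ENNReal.tsum_mul_left, ENNReal.tsum_geometric_two, mul_comm,
            ENNReal.ofReal_mul (by norm_num), ENNReal.ofReal_ofNat]
  refine (Finset.sum_le_sum h1).trans ?_
  rw [← ENNReal.ofReal_sum_of_nonneg fun s _ => by have := decay_nonneg s; positivity,
    ← Finset.mul_sum]
  exact ENNReal.ofReal_le_ofReal (mul_le_mul_of_nonneg_left (sum_decay_le _) (by norm_num))

end Expectation

/-! ### Expected number of charges -/

section Charges

/-- The indicator of the event that the lower confidence bound of an optimal configuration may
exceed its mean in iteration `s`. -/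
noncomputable def badCharge (μ : Measure ℝ) {Ω : Type*} (Y : ℕ → Ω → ℝ) (s : ℕ) : Ω → ℝ :=
  {ω | 2 ≤ s ∧ Bad μ (fun l => Y l ω) s fun r m => 1 + width m r s}.indicator 1

/-- The indicator of the event that `r` active instances are not representative, although there are
enough of them. -/
noncomputable def lowCharge {Ω : Type*} (Y : ℕ → Ω → ℝ) (q δ M ε : ℝ) (r : ℕ) : Ω → ℝ :=
  {ω | (1 ≤ r ∧ 2592 / (ε ^ 2 * δ) * Real.log r ≤ r) ∧
    Low (fun l => Y l ω) r q δ M (ε / 6)}.indicator 1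

theorem badCharge_nonneg (μ : Measure ℝ) {Ω : Type*} (Y : ℕ → Ω → ℝ) (s : ℕ) (ω : Ω) :
    0 ≤ badCharge μ Y s ω := Set.indicator_nonneg (fun _ _ => zero_le_one) _

theorem lowCharge_nonneg {Ω : Type*} (Y : ℕ → Ω → ℝ) (q δ M ε : ℝ) (r : ℕ) (ω : Ω) :
    0 ≤ lowCharge Y q δ M ε r ω := Set.indicator_nonneg (fun _ _ => zero_le_one) _

theorem lintegral_ofReal_indicator_one {Ω : Type*} [MeasurableSpace Ω] {P : Measure Ω}
    {A : Set Ω} (hA : MeasurableSet A) :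
    ∫⁻ ω, ENNReal.ofReal (A.indicator 1 ω) ∂P = P A := by
  rw [← lintegral_indicator_one hA]
  refine lintegral_congr fun ω => ?_
  by_cases h : ω ∈ A <;> simp [h]

variable {Ω : Type*} [MeasurableSpace Ω] {P : Measure Ω} [IsProbabilityMeasure P]
  {μ : Measure ℝ} {Y : ℕ → Ω → ℝ}

theorem measurable_badCharge (hY : ∀ l, Measurable (Y l)) (s : ℕ) :
    Measurable (badCharge μ Y s) :=
  measurable_one.indicator ((MeasurableSet.const _).inter (measurableSet_bad hY s _))

theorem measurable_lowCharge (hY : ∀ l, Measurable (Y l)) (q δ M ε : ℝ) (r : ℕ) :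
    Measurable (lowCharge Y q δ M ε r) :=
  measurable_one.indicator ((MeasurableSet.const _).inter (measurableSet_low hY r q δ M _))

theorem lintegral_badCharge_le (hY : ∀ l, Measurable (Y l)) (hind : iIndepFun Y P)
    (hμ : ∀ l, P.map (Y l) = μ) (s : ℕ) :
    ∫⁻ ω, ENNReal.ofReal (badCharge μ Y s ω) ∂P ≤ ENNReal.ofReal (4502 * decay s) := by
  unfold badCharge
  refine (lintegral_ofReal_indicator_one
    (by exact (MeasurableSet.const _).inter (measurableSet_bad hY s _))).le.trans ?_
  by_cases hs : 2 ≤ s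
  · exact (measure_mono fun ω hω => hω.2).trans (measure_bad_one_add_width_le hY hind hμ hs)
  · exact (measure_mono_null (t := ∅) (fun ω hω => hs hω.1) measure_empty).le.trans zero_le

theorem lintegral_lowCharge_le (hY : ∀ l, Measurable (Y l)) (hind : iIndepFun Y P)
    (hμ : ∀ l, P.map (Y l) = μ) (hY0 : ∀ l ω, 0 ≤ Y l ω) (r : ℕ) {q δ M ε : ℝ} (hq : 0 < q)
    (hδ : 0 < δ) (hε : 0 < ε) (hqδ : δ ≤ μ.real (Set.Ici q)) (hM : M = ∫ z, min z q ∂μ)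
    (hMδ : q * δ ≤ M) :
    ∫⁻ ω, ENNReal.ofReal (lowCharge Y q δ M ε r ω) ∂P ≤ ENNReal.ofReal (2 * decay r) := by
  unfold lowCharge
  refine (lintegral_ofReal_indicator_one
    (by exact (MeasurableSet.const _).inter (measurableSet_low hY r q δ M _))).le.trans ?_
  by_cases hr : 1 ≤ r ∧ 2592 / (ε ^ 2 * δ) * Real.log r ≤ r
  · refine (measure_mono fun ω hω => hω.2).trans ((measure_low_le hY hind hμ hY0 r hq hδ.le
      (by positivity : 0 ≤ ε / 6) hqδ hM hMδ).trans ?_)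
    rw [ENNReal.ofReal_mul (by norm_num), ENNReal.ofReal_ofNat]
    refine mul_le_mul_right (ENNReal.ofReal_le_ofReal ?_) _
    -- The threshold on r makes the exponent r δ (ε/6)² / 2 at least 36 ln r, far above (6/5) ln r.
    rw [decay_eq_exp hr.1, Real.exp_le_exp, neg_le_neg_iff]
    have h1 := hr.2
    rw [div_mul_eq_mul_div, div_le_iff₀ (by positivity)] at h1
    have h2 := Real.log_natCast_nonneg r
    linarith
  · exact (measure_mono_null (t := ∅) (fun ω hω => hr hω.1) measure_empty).le.trans zero_le

/-- The expected total charge is bounded by an absolute constant. -/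
theorem lintegral_charges_le {μ' : Measure ℝ} {Y' : ℕ → Ω → ℝ}
    (hY : ∀ l, Measurable (Y l)) (hind : iIndepFun Y P) (hμ : ∀ l, P.map (Y l) = μ)
    (hY' : ∀ l, Measurable (Y' l)) (hind' : iIndepFun Y' P) (hμ' : ∀ l, P.map (Y' l) = μ')
    (hY0 : ∀ l ω, 0 ≤ Y' l ω) {q δ M ε : ℝ} (hq : 0 < q)
    (hδ : 0 < δ) (hε : 0 < ε) (hqδ : δ ≤ μ'.real (Set.Ici q)) (hM : M = ∫ z, min z q ∂μ')
    (hMδ : q * δ ≤ M) (t : ℕ) :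
    ∫⁻ ω, ENNReal.ofReal (∑ s ∈ Finset.range (t + 1), badCharge μ Y s ω +
      ∑ r ∈ Finset.range t, lowCharge Y' q δ M ε r ω) ∂P ≤
      ENNReal.ofReal (4504 * ∑' s, decay s) := by
  have hb := badCharge_nonneg μ Y
  have hl := lowCharge_nonneg Y' q δ M ε
  have h0 : ∀ ω, ENNReal.ofReal (∑ s ∈ Finset.range (t + 1), badCharge μ Y s ω +
      ∑ r ∈ Finset.range t, lowCharge Y' q δ M ε r ω) =
      ∑ s ∈ Finset.range (t + 1), ENNReal.ofReal (badCharge μ Y s ω) +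
      ∑ r ∈ Finset.range t, ENNReal.ofReal (lowCharge Y' q δ M ε r ω) := fun ω => by
    rw [ENNReal.ofReal_add (Finset.sum_nonneg fun s _ => hb s ω)
      (Finset.sum_nonneg fun r _ => hl r ω), ENNReal.ofReal_sum_of_nonneg fun s _ => hb s ω,
      ENNReal.ofReal_sum_of_nonneg fun r _ => hl r ω]
  have hmb := fun s => (measurable_badCharge (μ := μ) hY s).ennreal_ofReal
  have hml := fun r => (measurable_lowCharge hY' q δ M ε r).ennreal_ofReal
  simp_rw [h0]
  rw [lintegral_add_left (Finset.measurable_sum _ fun s _ => hmb s),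
    lintegral_finsetSum _ fun s _ => hmb s, lintegral_finsetSum _ fun r _ => hml r]
  calc _ ≤ ∑ s ∈ Finset.range (t + 1), ENNReal.ofReal (4502 * decay s) +
        ∑ r ∈ Finset.range t, ENNReal.ofReal (2 * decay r) :=
      add_le_add (Finset.sum_le_sum fun s _ => lintegral_badCharge_le hY hind hμ s)
        (Finset.sum_le_sum fun r _ =>
          lintegral_lowCharge_le hY' hind' hμ' hY0 r hq hδ hε hqδ hM hMδ)
    _ = ENNReal.ofReal (4502 * ∑ s ∈ Finset.range (t + 1), decay s +
        2 * ∑ s ∈ Finset.range t, decay s) := by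
      have hd := decay_nonneg
      rw [← ENNReal.ofReal_sum_of_nonneg fun s _ => by have := hd s; positivity,
        ← ENNReal.ofReal_sum_of_nonneg fun s _ => by have := hd s; positivity,
        ← ENNReal.ofReal_add
          (Finset.sum_nonneg fun s _ => by have := hd s; positivity)
          (Finset.sum_nonneg fun s _ => by have := hd s; positivity),
        Finset.mul_sum, Finset.mul_sum]
    _ ≤ _ := by
      refine ENNReal.ofReal_le_ofReal ?_
      have h1 := sum_decay_le (Finset.range (t + 1))
      have h2 := sum_decay_le (Finset.range t)
      linarith

end Charges

end SPC

/-! ### Laws of the running times and the consequence of suboptimality -/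

namespace ConfigProblem

variable {N J : Type*} [MeasurableSpace J] (p : ConfigProblem N J)

/-- The distribution of the execution times of configuration `k`. -/
noncomputable def law (k : N) : Measure ℝ := p.Γ.map (p.R k)

theorem isProbabilityMeasure_law (k : N) : IsProbabilityMeasure (p.law k) :=
  have := p.isProb
  Measure.isProbabilityMeasure_map (p.measurable_R k).aemeasurable

theorem ae_law_le (k : N) : ∀ᵐ z ∂p.law k, p.κ₀ ≤ z := by
  rw [law, ae_map_iff (p.measurable_R k).aemeasurable measurableSet_Ici]
  exact Filter.Eventually.of_forall (p.κ₀_le k)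

theorem lintegral_law_Ioi (k : N) :
    ∫⁻ y in Set.Ioi (0 : ℝ), p.law k (Set.Ioi y) = p.meanRuntime k := by
  rw [meanRuntime, lintegral_eq_lintegral_meas_lt p.Γ
    (Filter.Eventually.of_forall fun j => p.κ₀_pos.le.trans (p.κ₀_le k j))
    (p.measurable_R k).aemeasurable]
  refine lintegral_congr fun y => ?_
  rw [law, Measure.map_apply (p.measurable_R k) measurableSet_Ioi]
  rfl

theorem le_meanRuntime (k : N) : ENNReal.ofReal p.κ₀ ≤ p.meanRuntime k := by
  have := p.isProb
  calc ENNReal.ofReal p.κ₀ = ∫⁻ _, ENNReal.ofReal p.κ₀ ∂p.Γ := by simp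
    _ ≤ _ := lintegral_mono fun j => ENNReal.ofReal_le_ofReal (p.κ₀_le k j)

theorem integrable_min_law (k : N) {q : ℝ} (hq : 0 < q) :
    Integrable (fun z => min z q) (p.law k) := by
  have := p.isProbabilityMeasure_law k
  refine Integrable.of_bound (by fun_prop) q ?_
  filter_upwards [p.ae_law_le k] with z hz
  rw [Real.norm_of_nonneg (le_min (p.κ₀_pos.le.trans hz) hq.le)]
  exact min_le_right _ _

theorem cappedMean_eq (k : N) {q : ℝ} (hq : 0 < q) :
    p.cappedMean k q = ENNReal.ofReal (∫ z, min z q ∂p.law k) := by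
  rw [ofReal_integral_eq_lintegral_ofReal (p.integrable_min_law k hq)]
  · rw [law, lintegral_map (by fun_prop) (p.measurable_R k)]
    rfl
  · filter_upwards [p.ae_law_le k] with z hz
    exact le_min (p.κ₀_pos.le.trans hz) hq.le

/-- Markov's inequality. It lets the capped sum share the deviation exponent of the count. -/
theorem mul_le_integral_min (k : N) {q δ : ℝ} (hq : 0 < q)
    (hδ : δ ≤ (p.law k).real (Set.Ici q)) : q * δ ≤ ∫ z, min z q ∂p.law k := by
  have h := mul_meas_ge_le_integral_of_nonneg (μ := p.law k) (f := fun z => min z q) (by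
    filter_upwards [p.ae_law_le k] with z hz
    exact le_min (p.κ₀_pos.le.trans hz) hq.le) (p.integrable_min_law k hq) q
  have h1 : {z : ℝ | q ≤ min z q} = Set.Ici q := by
    ext z; simp
  rw [h1] at h
  refine le_trans ?_ h
  gcongr

end ConfigProblem

namespace ConfigProblem

variable {N J : Type*} [MeasurableSpace J] (p : ConfigProblem N J)

/-- The quantile of a suboptimal configuration separates its capped mean from `OPT`. -/
theorem exists_quantile_of_suboptimal {i iStar : N} {ε δ : ℝ} (hopt : p.IsOptimal iStar)
    (hε : 0 < ε) (hδ : 0 < δ) (hδ1 : δ < 1) (hsub : p.IsEpsDeltaSuboptimal i ε δ) :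
    ∃ q m : ℝ, 0 < q ∧ δ ≤ (p.law i).real (Set.Ici q) ∧ p.κ₀ ≤ m ∧
      p.meanRuntime iStar = ENNReal.ofReal m ∧ (1 + ε) * m < ∫ z, min z q ∂p.law i := by
  have := p.isProbabilityMeasure_law i
  obtain ⟨q, hq0, hq1, hq2⟩ := SPC.exists_quantile (p.ae_law_le i) hδ hδ1
  have hq := p.κ₀_pos.trans_le hq0
  -- The quantile meets the probability condition, so suboptimality must come from the cost
  -- condition. This also rules out OPT = ∞.
  have h1 : ¬ p.cappedMean i q ≤ ENNReal.ofReal (1 + ε) * p.OPT := fun h => by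
    refine hsub ⟨q, hq, h, ?_⟩
    rw [law, Measure.map_apply (p.measurable_R i) measurableSet_Ioi] at hq1
    exact hq1
  have hfin : p.OPT ≠ ⊤ := fun h => by
    rw [h, ENNReal.mul_top (by simpa using by linarith)] at h1
    exact h1 le_top
  have hmean : p.meanRuntime iStar = ENNReal.ofReal p.OPT.toReal := by
    rw [ENNReal.ofReal_toReal hfin]; exact hopt
  refine ⟨q, p.OPT.toReal, hq, hq2, ?_, hmean, ?_⟩
  · rw [← ENNReal.ofReal_le_iff_le_toReal hfin, ← show _ = p.OPT from hopt]
    exact p.le_meanRuntime iStar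
  · rw [not_le, p.cappedMean_eq i hq, ← ENNReal.ofReal_toReal hfin,
      ← ENNReal.ofReal_mul (by linarith)] at h1
    exact (ENNReal.ofReal_lt_ofReal_iff_of_nonneg (by positivity)).1 h1

end ConfigProblem

/-! ### Assembly of the two bounds -/

namespace SPC

theorem lintegral_bounds {N J : Type*} [MeasurableSpace J] (p : ConfigProblem N J)
    {Ω : Type*} [MeasurableSpace Ω] {P : Measure Ω} [IsProbabilityMeasure P]
    {X : N → ℕ → Ω → J} (hX : ∀ k l, Measurable (X k l)) (hXlaw : ∀ k l, P.map (X k l) = p.Γ)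
    (hXind : ∀ k, iIndepFun (X k) P) {a : ℕ → Ω → N}
    (hrun : ∀ᵐ ω ∂P, IsRun p.κ₀ (fun k l => p.R k (X k l ω)) (fun t => a t ω))
    {i iStar : N} {ε δ q m : ℝ} {t : ℕ} (hε : 0 < ε) (hε1 : ε ≤ 1) (hδ : 0 < δ) (hδ1 : δ < 1)
    (ht : 2 ≤ t) (hq : 0 < q) (hqδ : δ ≤ (p.law i).real (Set.Ici q)) (hm : p.κ₀ ≤ m)
    (hmean : p.meanRuntime iStar = ENNReal.ofReal m)
    (hM : (1 + ε) * m < ∫ z, min z q ∂p.law i) :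
    ∫⁻ ω, ((states p.κ₀ (fun k l => p.R k (X k l ω)) (fun s => a s ω) t i).numActive :
        ℝ≥0∞) ∂P ≤ ENNReal.ofReal (2592 / (ε ^ 2 * δ) * Real.log t + 1 + 4504 * ∑' s, decay s) ∧
    ∫⁻ ω, ENNReal.ofReal
        (states p.κ₀ (fun k l => p.R k (X k l ω)) (fun s => a s ω) t i).time ∂P ≤
      ENNReal.ofReal (2295 * Real.exp 2 * m * Real.log t *
        (2592 / (ε ^ 2 * δ) + 4506 * ∑' s, decay s)) := by
  have hm0 := p.κ₀_pos.trans_le hm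
  have hS : 0 ≤ ∑' s, decay s := tsum_nonneg decay_nonneg
  have hlog := Real.log_natCast_nonneg t
  set Y : N → ℕ → Ω → ℝ := fun k l ω => p.R k (X k l ω) with hYdef
  have hY : ∀ k l, Measurable (Y k l) := fun k l => (p.measurable_R k).comp (hX k l)
  have hYlaw : ∀ k l, P.map (Y k l) = p.law k := fun k l => by
    rw [ConfigProblem.law, ← hXlaw k l, Measure.map_map (p.measurable_R k) (hX k l)]
    rfl
  have hYind : ∀ k, iIndepFun (Y k) P := fun k =>
    (hXind k).comp (fun _ => p.R k) fun _ => p.measurable_R k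
  have hx : ∀ ω k l, p.κ₀ ≤ (fun k l => p.R k (X k l ω)) k l := fun ω k l => p.κ₀_le _ _
  have hmean' := hmean ▸ p.lintegral_law_Ioi iStar
  have hprob := p.isProbabilityMeasure_law iStar
  have hprob' := p.isProbabilityMeasure_law i
  set M := ∫ z, min z q ∂p.law i with hMdef
  set ρ := 2592 / (ε ^ 2 * δ) with hρdef
  have hρ : 1 ≤ ρ := by
    rw [hρdef, one_le_div (by positivity)]
    nlinarith [mul_pos hε hε]
  set K : Ω → ℝ := fun ω => ∑ s ∈ Finset.range (t + 1), badCharge (p.law iStar) (Y iStar) s ω +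
      ∑ r ∈ Finset.range t, lowCharge (Y i) q δ M ε r ω with hKdef
  have hK0 : ∀ ω, 0 ≤ K ω := fun ω => add_nonneg
    (Finset.sum_nonneg fun s _ => badCharge_nonneg _ _ s ω)
    (Finset.sum_nonneg fun r _ => lowCharge_nonneg _ q δ M ε r ω)
  have hKint : ∫⁻ ω, ENNReal.ofReal (K ω) ∂P ≤ ENNReal.ofReal (4504 * ∑' s, decay s) :=
    lintegral_charges_le (hY iStar) (hYind iStar) (hYlaw iStar) (hY i) (hYind i) (hYlaw i)
      (fun l ω => p.κ₀_pos.le.trans (p.κ₀_le _ _)) hq hδ hε hqδ hMdef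
      (p.mul_le_integral_min i hq hqδ) t
  have hWint := lintegral_excess_le (hY iStar) (hYind iStar) (hYlaw iStar) t
  have hcount : ∀ ω, IsRun p.κ₀ (fun k l => p.R k (X k l ω)) (fun t => a t ω) → ∀ n ≤ t,
      ((states p.κ₀ (fun k l => p.R k (X k l ω)) (fun s => a s ω) n i).numActive : ℝ) ≤
        ρ * Real.log n + 1 + K ω := fun ω hω =>
    numActive_states_le_of_isRun (iStar := iStar) p.κ₀_pos (hx ω) hω hm0 hmean' hq hδ hε hε1 hM
      (fun s => badCharge_nonneg _ _ s ω) (fun r => lowCharge_nonneg _ q δ M ε r ω)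
      (fun s hs hbad => by
        rw [badCharge, Set.indicator_of_mem (by exact ⟨hs, hbad⟩)]; rfl)
      (fun r hr1 hr2 hlow => by
        rw [lowCharge, Set.indicator_of_mem (by exact ⟨⟨hr1, hr2⟩, hlow⟩)]; rfl)
  constructor
  · calc _ ≤ ∫⁻ ω, (ENNReal.ofReal (ρ * Real.log t + 1) + ENNReal.ofReal (K ω)) ∂P := by
          refine lintegral_mono_ae ?_
          filter_upwards [hrun] with ω hω
          rw [← ENNReal.ofReal_natCast, ← ENNReal.ofReal_add (by positivity) (hK0 ω)]
          exact ENNReal.ofReal_le_ofReal (hcount ω hω t le_rfl)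
      _ ≤ ENNReal.ofReal (ρ * Real.log t + 1) + ENNReal.ofReal (4504 * ∑' s, decay s) := by
          rw [lintegral_add_left measurable_const]
          simp only [lintegral_const, measure_univ, mul_one]
          gcongr
      _ = _ := (ENNReal.ofReal_add (by positivity) (by positivity)).symm
  · set A := 2295 * Real.exp 2 * m * Real.log t with hA
    have hA0 : 0 < A := by
      have := half_le_log_two.trans (log_two_le_log ht)
      have : 0 < Real.log t := by linarith
      positivity
    calc _ ≤ ∫⁻ ω, ENNReal.ofReal A * (excess (p.law iStar) (Y iStar) t ω +
            (ENNReal.ofReal ρ + ENNReal.ofReal (K ω))) ∂P := by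
          refine lintegral_mono_ae ?_
          filter_upwards [hrun] with ω hω
          -- If the excess is infinite, the right-hand integrand is infinite, so no almost sure
          -- finiteness is needed.
          by_cases htop : excess (p.law iStar) (Y iStar) t ω = ⊤
          · rw [htop, top_add, ENNReal.mul_top (by simpa using hA0)]
            exact le_top
          have h := time_states_le_of_isRun (iStar := iStar) p.κ₀_pos (hx ω) hω hm hmean' ht hρ
            (hK0 ω) ENNReal.toReal_nonneg (hcount ω hω)
            (fun s hs hst => exists_not_bad_of_excess_ne_top htop hs hst)
          refine (ENNReal.ofReal_le_ofReal h).trans (le_of_eq ?_)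
          rw [ENNReal.ofReal_mul hA0.le, ENNReal.ofReal_add
            (add_nonneg (zero_le_one.trans hρ) (hK0 ω)) ENNReal.toReal_nonneg,
            ENNReal.ofReal_add (zero_le_one.trans hρ) (hK0 ω), ENNReal.ofReal_toReal htop, add_comm]
      _ ≤ ENNReal.ofReal A * (ENNReal.ofReal (2 * ∑' s, decay s) +
            (ENNReal.ofReal ρ + ENNReal.ofReal (4504 * ∑' s, decay s))) := by
          rw [lintegral_const_mul' _ _ ENNReal.ofReal_ne_top,
            lintegral_add_left (measurable_excess (hY iStar) t), lintegral_add_left measurable_const]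
          simp only [lintegral_const, measure_univ, mul_one]
          gcongr
      _ = _ := by
          rw [← ENNReal.ofReal_add (by positivity) (by positivity),
            ← ENNReal.ofReal_add (by positivity) (by positivity), ← ENNReal.ofReal_mul hA0.le]
          congr 2; ring

end SPC

theorem mainTheorem3 :
    ∃ C : ℝ, 0 < C ∧
      ∀ (N : Type u) [Finite N] (J : Type v) [MeasurableSpace J] (p : ConfigProblem N J)
        (Ω : Type w) [MeasurableSpace Ω] (P : Measure Ω) [IsProbabilityMeasure P]
        -- `X k 0, X k 1, …` is the stream of i.i.d. instances of the tester of `k`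
        (X : N → ℕ → Ω → J)
        (_ : ∀ k l, Measurable (X k l))
        (_ : ∀ k l, P.map (X k l) = p.Γ)
        (_ : ∀ k, iIndepFun (X k) P)
        -- `a t` is the configuration selected in iteration `t + 1`
        (a : ℕ → Ω → N)
        (_ : ∀ t k, MeasurableSet {ω | a t ω = k})
        (_ : ∀ᵐ ω ∂P, SPC.IsRun p.κ₀ (fun k l => p.R k (X k l ω)) (fun t => a t ω))
        (i iStar : N) (ε δ : ℝ) (t : ℕ),
        p.IsOptimal iStar →
        0 < ε → ε ≤ 1 → 0 < δ → δ < 1 →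
        p.IsEpsDeltaSuboptimal i ε δ →
        2 ≤ t → 1 ≤ t * (Real.logb 2 (1 / δ)) ^ 2 →
        ∫⁻ ω, ((SPC.states p.κ₀ (fun k l => p.R k (X k l ω)) (fun s => a s ω) t i).numActive :
            ℝ≥0∞) ∂P ≤ ENNReal.ofReal (C * SPC.bound t ε δ) ∧
        ∫⁻ ω, ENNReal.ofReal
            (SPC.states p.κ₀ (fun k l => p.R k (X k l ω)) (fun s => a s ω) t i).time ∂P ≤
          p.meanRuntime iStar * ENNReal.ofReal (C * SPC.bound t ε δ) := by
  have hS : 0 ≤ ∑' s, SPC.decay s := tsum_nonneg SPC.decay_nonneg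
  set S := ∑' s, SPC.decay s
  -- 4590 = 2 · 2295 makes up for the factor 1/2 in `le_bound`. Because u L ≥ 1/2 and u ≥ 1, the
  -- factor 2594 + 9008 S absorbs the additive constants of both estimates.
  refine ⟨4590 * Real.exp 2 * (2594 + 9008 * S), by positivity, ?_⟩
  intro N _ J _ p Ω _ P _ X hX hXlaw hXind a _ hrun i iStar ε δ t hopt hε hε1 hδ hδ1 hsub ht htδ
  obtain ⟨q, m, hq, hqδ, hm, hmean, hM⟩ :=
    p.exists_quantile_of_suboptimal hopt hε hδ hδ1 hsub
  have hm0 := p.κ₀_pos.trans_le hm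
  obtain ⟨h1, h2⟩ := SPC.lintegral_bounds p hX hXlaw hXind hrun hε hε1 hδ hδ1 ht hq hqδ hm hmean hM
  have hL : 1 / 2 ≤ Real.log t := SPC.half_le_log_two.trans (SPC.log_two_le_log ht)
  have hB := SPC.le_bound (ε := ε) ht hδ hδ1 htδ
  have hu : 1 ≤ (ε ^ 2)⁻¹ * δ⁻¹ :=
    one_le_mul_of_one_le_of_one_le ((one_le_inv₀ (by positivity)).2 (pow_le_one₀ hε.le hε1))
      ((one_le_inv₀ hδ).2 hδ1.le)
  have hρ : 2592 / (ε ^ 2 * δ) = 2592 * ((ε ^ 2)⁻¹ * δ⁻¹) := by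
    rw [div_eq_mul_inv, mul_inv]
  rw [hρ] at h1 h2
  have hexp : 1 ≤ Real.exp 2 := Real.one_le_exp (by norm_num)
  set u := (ε ^ 2)⁻¹ * δ⁻¹
  set L := Real.log t
  have hCB : 2295 * Real.exp 2 * (2594 + 9008 * S) * (u * L) ≤
      4590 * Real.exp 2 * (2594 + 9008 * S) * SPC.bound t ε δ := by
    have : 4590 * Real.exp 2 * (2594 + 9008 * S) * (u * (L / 2)) ≤
      4590 * Real.exp 2 * (2594 + 9008 * S) * SPC.bound t ε δ := by gcongr
    linarith
  have huL : 1 / 2 ≤ u * L := by nlinarith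
  constructor
  · refine h1.trans (ENNReal.ofReal_le_ofReal (le_trans ?_ hCB))
    calc 2592 * u * L + 1 + 4504 * S ≤ (2594 + 9008 * S) * (u * L) := by nlinarith
      _ ≤ 2295 * Real.exp 2 * ((2594 + 9008 * S) * (u * L)) :=
          le_mul_of_one_le_left (by positivity) (by linarith)
      _ = _ := by ring
  · rw [hmean, ← ENNReal.ofReal_mul hm0.le]
    refine h2.trans (ENNReal.ofReal_le_ofReal ?_)
    refine le_trans ?_ (mul_le_mul_of_nonneg_left hCB hm0.le)
    calc 2295 * Real.exp 2 * m * L * (2592 * u + 4506 * S)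
        ≤ 2295 * Real.exp 2 * m * L * ((2594 + 9008 * S) * u) := by
          gcongr; nlinarith
      _ = _ := by ring
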